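/- Let $\mathcal X$ (contexts) and $\mathcal A$ (arms) be finite sets, let $p$ be a probability distribution on $\mathcal X$ with $p(x)>0$ for all $x$, let $\phi_{x,a}\in\mathbb R^d$ be known features, and let $\alpha=(\alpha_{x,a})$ be a fixed sampling allocation, i.e. $(\alpha_{x,a})_{a\in\mathcal A}$ is a probability distribution on $\mathcal A$ for each $x$. Under a parameter $\theta\in\mathbb R^d$, independent rounds $(x_t,a_t,r_t)$, $t\ge1$, are observed, where $x_t\sim p$, $a_t\sim\alpha_{x_t,\cdot}$ given $x_t$, and $r_t\sim\mathcal N(\theta^\top\phi_{x_t,a_t},1)$ given $(x_t,a_t)$; write $\mathbb P_\theta,\mathbb E_\theta$ for the resulting law and expectation. Let $\mathcal D_t$ be the data of rounds $1,\dots,t$ and $\mathcal F_t=\sigma(\mathcal D_t,x_{t+1})$. A (passive) algorithm consists of a stopping time $\tau$ with respect to $(\mathcal F_t)$ and an $\mathcal F_\tau$-measurable recommended policy $\hat a_\tau:\mathcal X\to\mathcal A$. Write $\Delta_\theta(x,a)=\max_{b}\theta^\top\phi_{x,b}-\theta^\top\phi_{x,a}$. For a linear subspace $U$ of $\mathbb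 R^d$, $\varepsilon\ge0$ and $\delta\in(0,1)$, the algorithm is $(U,\varepsilon,\delta)$-PAC if for every $\theta\in U$ $$\mathbb P_\theta\bigl(\exists x\in\mathcal X:\ \Delta_\theta(x,\hat a_\tau(x))>\varepsilon\bigr)\le\delta\quad\text{and}\quad \mathbb P_\theta(\tau<\infty)=1,$$ and $U$ is PAC-learnable if a $(U,\varepsilon,\delta)$-PAC algorithm exists for some $\varepsilon$ and $\delta$. Let $\Phi_\alpha=\{\phi_{x,a}:\alpha_{x,a}>0\}$ and $A(\alpha)=\sum_{x,a}\alpha_{x,a}\,p(x)\,\phi_{x,a}\phi_{x,a}^\top$. Let $\mathcal A_\varepsilon(\theta,x)=\{a:\Delta_\theta(x,a)<\varepsilon\}$ if $\varepsilon>0$, let $\mathcal A_0(\theta,x)=\{a:\Delta_\theta(x,a)=0\}$, and let $$B_\varepsilon(\theta)=\{\mu\in\mathbb R^d:\ \exists x\in\mathcal X\ \forall a\in\mathcal A_\varepsilon(\theta,x):\ \Delta_\mu(x,a)>\varepsilon\},\qquad \psi_{\theta,\varepsilon}(\alpha)=\inf_{\mu\in B_\varepsilon(\theta)\cap U}\tfrac12(\mu-\theta)^\top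 A(\alpha)(\mu-\theta),$$ with $\inf\emptyset=\infty$, $\infty^{-1}=0$, $0^{-1}=\infty$, $\infty\cdot 0=0$. Finally let $\mathrm{kl}(a,b)=a\log\frac ab+(1-a)\log\frac{1-a}{1-b}$. **Theorem.** Let $U$ be a linear subspace of $\mathrm{Span}(\Phi_\alpha)$. Then $U$ is PAC-learnable; indeed, for all $\varepsilon>0$ and $\delta\in(0,1)$ there is a $(U,\varepsilon,\delta)$-PAC algorithm, and its $\tau$ can be taken to be a stopping time with respect to $(\sigma(\mathcal D_t))_t$. Moreover, let $\varepsilon\ge0$, $\delta\in(0,\tfrac12]$ and $\theta\in U$. Every $(U,\varepsilon,\delta)$-PAC algorithm whose $\tau$ is a stopping time with respect to $(\sigma(\mathcal D_t))_t$ satisfies $$\mathbb E_\theta[\tau]\ \ge\ \psi_{\theta,\varepsilon}(\alpha)^{-1}\,\mathrm{kl}(\delta,1-\delta).$$ Every $(U,\varepsilon,\delta)$-PAC algorithm, including those whose decision to stop after $t$ rounds also uses the context $x_{t+1}$ of the coming round, satisfies the same inequality with $\mathbb E_\theta[\tau]+1$ (the expected number of contexts that it has observed) in place of $\mathbb E_\theta[\tau]$.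 -/

import Mathlib

open MeasureTheory ProbabilityTheory
open scoped ENNReal

namespace CLMAB

noncomputable section

/-- The data of a contextual linear bandit with `C` contexts, `K` arms and parameter space `ℝ^d`,
in the passive setting: the context distribution, the feature map and the fixed sampling
allocation (for every context, a distribution over the arms). -/
structure PassiveModel (d C K : ℕ) where
  contextDist : PMF (Fin C)
  feature : Fin C → Fin K → (Fin d → ℝ)
  allocation : Fin C → PMF (Fin K)

/-- What is observed in one round: context, arm, reward. -/
abbrev Round (C K : ℕ) : Type := Fin C × Fin K × ℝ

/-- An infinite sequence of rounds; `ω s` is the `(s + 1)`-st round. -/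
abbrev History (C K : ℕ) : Type := ℕ → Round C K

/-- The σ-algebra generated by the first `t` rounds. -/
abbrev dataSigma (C K t : ℕ) : MeasurableSpace (History C K) :=
  ⨆ s : Fin t, MeasurableSpace.comap (fun ω : History C K => ω s) inferInstance

/-- The filtration of the observed data: at time `t` it is generated by the first `t` rounds. -/
def dataFiltration (C K : ℕ) :
    Filtration ℕ (inferInstance : MeasurableSpace (History C K)) where
  seq t := dataSigma C K t
  mono' := fun _ j hij => iSup_le fun s =>
    le_iSup (fun r : Fin j => MeasurableSpace.comap (fun ω : History C K => ω r) inferInstance)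
      (Fin.castLE hij s)
  le' := fun _ => iSup_le fun s => (measurable_pi_apply (s : ℕ)).comap_le

/-- The filtration that also knows the context of the coming round: at time `t` it is generated by
the first `t` rounds and the context of round `t + 1`. -/
def infoFiltration (C K : ℕ) :
    Filtration ℕ (inferInstance : MeasurableSpace (History C K)) where
  seq t := dataSigma C K t ⊔ MeasurableSpace.comap (fun ω : History C K => (ω t).1) inferInstance
  mono' := by
    intro i j hij
    rcases hij.eq_or_lt with rfl | hlt
    · exact le_rfl
    · refine sup_le (((dataFiltration C K).mono hij).trans le_sup_left) (le_trans ?_ le_sup_left)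
      refine le_trans ?_ (le_iSup (fun r : Fin j =>
        MeasurableSpace.comap (fun ω : History C K => ω r) inferInstance) ⟨i, hlt⟩)
      rintro _ ⟨s, hs, rfl⟩
      exact ⟨Prod.fst ⁻¹' s, measurable_fst hs, rfl⟩
  le' := fun t => sup_le ((dataFiltration C K).le t)
    (measurable_fst.comp (measurable_pi_apply t)).comap_le

/-- An algorithm of the passive setting: a stopping rule and a recommendation rule. The
recommended policy assigns an arm to every context and depends only on what is known when the
algorithm stops. -/
structure PassiveAlgorithm (C K : ℕ) where
  stoppingTime : History C K → WithTop ℕ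
  isStoppingTime : IsStoppingTime (infoFiltration C K) stoppingTime
  recommend : History C K → (Fin C → Fin K)
  measurable_recommend : Measurable[isStoppingTime.measurableSpace] recommend

/-- The stopping rule uses the completed rounds only, not the context of the coming round. -/
def PassiveAlgorithm.StopsOnData {C K : ℕ} (alg : PassiveAlgorithm C K) : Prop :=
  IsStoppingTime (dataFiltration C K) alg.stoppingTime

namespace PassiveModel

variable {d C K : ℕ} (M : PassiveModel d C K)

/-- The law of one round under the parameter `θ`: the context `x` is drawn from the context
distribution, the arm `a` from the allocation at `x`, and the reward is Gaussian with mean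
`θᵀ φ_{x,a}` and variance `1`. -/
def roundLaw (θ : Fin d → ℝ) : Measure (Round C K) :=
  ∑ x, ∑ a, (M.contextDist x * M.allocation x a) •
    (gaussianReal (θ ⬝ᵥ M.feature x a) 1).map (fun r => (x, a, r))

instance isProbabilityMeasure_roundLaw (θ : Fin d → ℝ) :
    IsProbabilityMeasure (M.roundLaw θ) := by
  constructor
  have hp : ∑ x, M.contextDist x = 1 := by
    rw [← tsum_fintype (L := .unconditional _)]; exact M.contextDist.tsum_coe
  have ha : ∀ x, ∑ a, M.allocation x a = 1 := fun x => by
    rw [← tsum_fintype (L := .unconditional _)]; exact (M.allocation x).tsum_coe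
  have hg : ∀ x a, ((gaussianReal (θ ⬝ᵥ M.feature x a) 1).map
      (fun r => ((x, a, r) : Round C K))) Set.univ = 1 := fun x a => by
    rw [Measure.map_apply (by fun_prop) MeasurableSet.univ]
    simp
  simp only [roundLaw, Measure.coe_finsetSum, Finset.sum_apply, Measure.smul_apply, hg,
    smul_eq_mul, mul_one]
  simp only [← Finset.mul_sum, ha, mul_one, hp]

/-- `ℙ_θ`: the rounds are independent and identically distributed. -/
def law (θ : Fin d → ℝ) : Measure (History C K) :=
  Measure.infinitePi fun _ : ℕ => M.roundLaw θ

/-- `θᵀ (φ_{x,a⋆} - φ_{x,a})`, where `a⋆` is a best arm for `θ` in the context `x`. -/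
def gap (θ : Fin d → ℝ) (x : Fin C) (a : Fin K) : ℝ :=
  (⨆ b, θ ⬝ᵥ M.feature x b) - θ ⬝ᵥ M.feature x a

/-- The `ε`-optimal arms: those with gap less than `ε`. The second alternative matters for `ε = 0`
only, where it makes them the optimal arms. -/
def epsOptimal (ε : ℝ) (θ : Fin d → ℝ) (x : Fin C) : Set (Fin K) :=
  {a | M.gap θ x a < ε ∨ M.gap θ x a = 0}

/-- The confusing parameters `B_ε(θ)`. -/
def confusing (ε : ℝ) (θ : Fin d → ℝ) : Set (Fin d → ℝ) :=
  {μ | ∃ x, ∀ a ∈ M.epsOptimal ε θ x, ε < M.gap μ x a}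

/-- The matrix `A(α) = ∑ φ_{x,a} φ_{x,a}ᵀ α_{x,a} p(x)`. -/
def designMatrix : Matrix (Fin d) (Fin d) ℝ :=
  ∑ x, ∑ a, ((M.allocation x a).toReal * (M.contextDist x).toReal) •
    Matrix.vecMulVec (M.feature x a) (M.feature x a)

/-- `Φ_α`: the features that the allocation samples. -/
def sampledFeatures : Set (Fin d → ℝ) :=
  {v | ∃ x a, 0 < M.allocation x a ∧ M.feature x a = v}

/-- `ψ_{θ,ε}(α)`: the infimum of `½ ‖μ - θ‖²_{A(α)}` over the confusing parameters in `U`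
(`∞` if there is none). -/
def psi (U : Submodule ℝ (Fin d → ℝ)) (ε : ℝ) (θ : Fin d → ℝ) : ℝ≥0∞ :=
  ⨅ μ ∈ M.confusing ε θ ∩ U,
    ENNReal.ofReal (1 / 2 * ((μ - θ) ⬝ᵥ M.designMatrix.mulVec (μ - θ)))

/-- `(U, ε, δ)`-PAC algorithms. -/
def IsPAC (U : Submodule ℝ (Fin d → ℝ)) (ε δ : ℝ) (alg : PassiveAlgorithm C K) : Prop :=
  ∀ θ ∈ U, M.law θ {ω | ∃ x, ε < M.gap θ x (alg.recommend ω x)} ≤ ENNReal.ofReal δ ∧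
    M.law θ {ω | alg.stoppingTime ω < ⊤} = 1

/-- `U` is PAC-learnable: some algorithm is `(U, ε, δ)`-PAC for some `ε` and `δ`. -/
def IsPACLearnable (U : Submodule ℝ (Fin d → ℝ)) : Prop :=
  ∃ ε δ : ℝ, 0 ≤ ε ∧ 0 < δ ∧ δ < 1 ∧ ∃ alg : PassiveAlgorithm C K, M.IsPAC U ε δ alg

/-- The expected sample complexity `𝔼_θ[τ]`. -/
def expectedSamples (θ : Fin d → ℝ) (alg : PassiveAlgorithm C K) : ℝ≥0∞ :=
  ∫⁻ ω, ENat.toENNReal (alg.stoppingTime ω) ∂(M.law θ)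

end PassiveModel

/-- `kl(a, b)`: the Kullback-Leibler divergence between the Bernoulli distributions of means
`a` and `b`, for `a, b ∈ (0, 1)`. -/
def bernoulliKL (a b : ℝ) : ℝ :=
  a * Real.log (a / b) + (1 - a) * Real.log ((1 - a) / (1 - b))

end

end CLMAB

namespace CLMAB

/-! Lower bound. Under `θ`, the log-likelihood ratio of `θ` against `μ`, summed up to an integrable
stopping time `σ` of the data filtration, has mean `𝔼_θ[σ]` times the divergence `½ ‖μ - θ‖²_{A(α)}`
of one round (`integral_logRatio` and Wald's identity, `integral_stopped_sum`). Integrating `exp y ≥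
1 + y` turns this into an inequality between the probabilities under `θ` and `μ` of any event known
at `σ` (`change_of_measure`). For a confusing `μ ∈ U`, the event that the recommendation has gap
greater than `ε` under `μ` has probability at most `δ` under `μ` and at least `1 - δ` under `θ`; the
inequality then yields the `kl` term.

Two points need care. The `ε`-optimal arms exclude gap exactly `ε > 0`, which the PAC condition at
`θ` tolerates. Such a gap exceeds `ε` under `(1 + η) • θ`, and moving there costs a divergence of
order `η²` against a gain of order `η`, so `η → 0` settles it (`IsPAC.real_notMem_epsOptimal_le`).
Secondly, Wald's identity needs the decision to play a round to be independent of that round, which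
may fail once its context has been seen; then `τ + 1` is a stopping time of the data, whence the
extra `1`. The recommendation may use that context at no cost, since the law of a context does not
involve the parameter (`law_apply_of_measurableSet_info`).

Learnability. A deterministic horizon suffices. For `θ` in the span of the sampled features every
mean reward is a fixed linear combination of sampled ones (`exists_coefficients`), and these are
estimated by empirical means. Histories under `θ` are shifted histories under `0`
(`law_eq_map_shift`), so a horizon from the law of large numbers at `0` serves all `θ` at once. -/

/-- The density of one unit-variance Gaussian with respect to another. -/
lemma gaussianReal_eq_withDensity_exp (m m' : ℝ) :
    gaussianReal m' 1 = (gaussianReal m 1).withDensity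
      (fun r => ENNReal.ofReal (Real.exp (-((m - m') * (r - m) + (m - m') ^ 2 / 2)))) := by
  rw [gaussianReal_of_var_ne_zero _ one_ne_zero, gaussianReal_of_var_ne_zero _ one_ne_zero,
    ← withDensity_mul _ (measurable_gaussianPDF _ _) (by fun_prop)]
  congr 1
  ext r
  simp only [Pi.mul_apply, gaussianPDF, gaussianPDFReal]
  rw [← ENNReal.ofReal_mul (by positivity), mul_assoc (√_)⁻¹, ← Real.exp_add]
  congr 3
  push_cast
  ring

/-! ### The law of one round: likelihood ratio, divergence, shift. -/

namespace PassiveModel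

variable {d C K : ℕ} (M : PassiveModel d C K)

lemma measurable_of_contexts_arms {β : Type*} [MeasurableSpace β] {f : Round C K → β}
    (hf : ∀ x a, Measurable fun r => f (x, a, r)) : Measurable f :=
  measurable_from_prod_countable_right fun x =>
    measurable_from_prod_countable_right fun a => hf x a

/-- The log-likelihood ratio of one round between the parameters `θ` and `μ`. -/
noncomputable def logRatio (θ μ : Fin d → ℝ) (z : Round C K) : ℝ :=
  (θ ⬝ᵥ M.feature z.1 z.2.1 - μ ⬝ᵥ M.feature z.1 z.2.1) * (z.2.2 - θ ⬝ᵥ M.feature z.1 z.2.1) +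
    (θ ⬝ᵥ M.feature z.1 z.2.1 - μ ⬝ᵥ M.feature z.1 z.2.1) ^ 2 / 2

lemma measurable_logRatio (θ μ : Fin d → ℝ) : Measurable (M.logRatio θ μ) :=
  measurable_of_contexts_arms fun x a => by simp only [logRatio]; fun_prop

lemma measurable_mk (x : Fin C) (a : Fin K) : Measurable fun r : ℝ => ((x, a, r) : Round C K) := by
  fun_prop

lemma lintegral_roundLaw (θ : Fin d → ℝ) {f : Round C K → ℝ≥0∞} (hf : Measurable f) :
    ∫⁻ z, f z ∂(M.roundLaw θ) = ∑ x, ∑ a, (M.contextDist x * M.allocation x a) *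
      ∫⁻ r, f (x, a, r) ∂(gaussianReal (θ ⬝ᵥ M.feature x a) 1) := by
  simp only [roundLaw, lintegral_finsetSum_measure, lintegral_smul_measure, smul_eq_mul]
  simp only [lintegral_map hf (measurable_mk _ _)]

lemma roundLaw_apply (θ : Fin d → ℝ) {s : Set (Round C K)} (hs : MeasurableSet s) :
    M.roundLaw θ s = ∑ x, ∑ a, (M.contextDist x * M.allocation x a) *
      gaussianReal (θ ⬝ᵥ M.feature x a) 1 {r | (x, a, r) ∈ s} := by
  simp only [roundLaw, Measure.coe_finsetSum, Finset.sum_apply, Measure.smul_apply, smul_eq_mul,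
    Measure.map_apply (measurable_mk _ _) hs]
  rfl

lemma roundLaw_eq_withDensity (θ μ : Fin d → ℝ) :
    M.roundLaw μ = (M.roundLaw θ).withDensity
      (fun z => ENNReal.ofReal (Real.exp (-M.logRatio θ μ z))) := by
  have hm : Measurable fun z : Round C K => ENNReal.ofReal (Real.exp (-M.logRatio θ μ z)) :=
    (Real.measurable_exp.comp (M.measurable_logRatio θ μ).neg).ennreal_ofReal
  ext s hs
  rw [withDensity_apply _ hs, ← lintegral_indicator hs, M.lintegral_roundLaw θ (hm.indicator hs),
    M.roundLaw_apply μ hs]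
  refine Finset.sum_congr rfl fun x _ => Finset.sum_congr rfl fun a _ => ?_
  have hs' : MeasurableSet {r : ℝ | ((x, a, r) : Round C K) ∈ s} := measurable_mk x a hs
  rw [gaussianReal_eq_withDensity_exp (θ ⬝ᵥ M.feature x a), withDensity_apply _ hs',
    ← lintegral_indicator hs']
  rfl

lemma integrable_roundLaw (θ : Fin d → ℝ) {f : Round C K → ℝ}
    (hf : ∀ x a, Integrable (fun r => f (x, a, r)) (gaussianReal (θ ⬝ᵥ M.feature x a) 1))
    (hm : Measurable f) : Integrable f (M.roundLaw θ) := by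
  refine integrable_finsetSum_measure.2 fun x _ => integrable_finsetSum_measure.2 fun a _ => ?_
  refine Integrable.smul_measure ?_
    (ENNReal.mul_ne_top (PMF.apply_ne_top _ _) (PMF.apply_ne_top _ _))
  rw [integrable_map_measure hm.aestronglyMeasurable (measurable_mk _ _).aemeasurable]
  exact hf x a

lemma integral_roundLaw (θ : Fin d → ℝ) {f : Round C K → ℝ}
    (hf : ∀ x a, Integrable (fun r => f (x, a, r)) (gaussianReal (θ ⬝ᵥ M.feature x a) 1))
    (hm : Measurable f) :
    ∫ z, f z ∂(M.roundLaw θ) = ∑ x, ∑ a, ((M.contextDist x).toReal * (M.allocation x a).toReal) *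
      ∫ r, f (x, a, r) ∂(gaussianReal (θ ⬝ᵥ M.feature x a) 1) := by
  have hi := M.integrable_roundLaw θ hf hm
  rw [roundLaw] at hi ⊢
  rw [integral_finsetSum_measure (integrable_finsetSum_measure.1 hi)]
  refine Finset.sum_congr rfl fun x hx => ?_
  have hi' := integrable_finsetSum_measure.1 hi x hx
  rw [integral_finsetSum_measure (integrable_finsetSum_measure.1 hi')]
  refine Finset.sum_congr rfl fun a _ => ?_
  rw [integral_smul_measure, integral_map (measurable_mk _ _).aemeasurable
    hm.aestronglyMeasurable, ENNReal.toReal_mul, smul_eq_mul]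

lemma integrable_sub_gaussianReal (m : ℝ) : Integrable (fun r => r - m) (gaussianReal m 1) :=
  ((memLp_id_gaussianReal 1).integrable (by simp)).sub (integrable_const m)

lemma integrable_logRatio_gaussianReal (θ μ : Fin d → ℝ) (x : Fin C) (a : Fin K) :
    Integrable (fun r => M.logRatio θ μ (x, a, r)) (gaussianReal (θ ⬝ᵥ M.feature x a) 1) := by
  simp only [logRatio]
  exact ((integrable_sub_gaussianReal _).const_mul _).add (integrable_const _)

lemma integrable_logRatio (θ μ : Fin d → ℝ) : Integrable (M.logRatio θ μ) (M.roundLaw θ) :=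
  M.integrable_roundLaw θ (M.integrable_logRatio_gaussianReal θ μ) (M.measurable_logRatio θ μ)

/-- The Kullback-Leibler divergence of one round. -/
lemma integral_logRatio (θ μ : Fin d → ℝ) :
    ∫ z, M.logRatio θ μ z ∂(M.roundLaw θ) =
      1 / 2 * ((μ - θ) ⬝ᵥ M.designMatrix.mulVec (μ - θ)) := by
  rw [M.integral_roundLaw θ (M.integrable_logRatio_gaussianReal θ μ) (M.measurable_logRatio θ μ)]
  have h1 : ∀ x a, ∫ r, M.logRatio θ μ (x, a, r) ∂(gaussianReal (θ ⬝ᵥ M.feature x a) 1) =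
      ((μ - θ) ⬝ᵥ M.feature x a) ^ 2 / 2 := fun x a => by
    simp only [logRatio]
    rw [integral_add ((integrable_sub_gaussianReal _).const_mul _) (integrable_const _),
      integral_const_mul, integral_sub (f := fun r => r)
        ((memLp_id_gaussianReal 1).integrable (by simp)) (integrable_const _),
      integral_id_gaussianReal, sub_dotProduct]
    simp
    ring
  simp only [h1, designMatrix, Matrix.sum_mulVec, dotProduct_sum, Matrix.smul_mulVec,
    dotProduct_smul, Matrix.vecMulVec_mulVec, Finset.mul_sum]
  refine Finset.sum_congr rfl fun x _ => Finset.sum_congr rfl fun a _ => ?_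
  simp [dotProduct_comm (M.feature x a)]
  ring

lemma quadratic_nonneg (v : Fin d → ℝ) : 0 ≤ v ⬝ᵥ M.designMatrix.mulVec v := by
  simp only [designMatrix, Matrix.sum_mulVec, dotProduct_sum, Matrix.smul_mulVec,
    dotProduct_smul, Matrix.vecMulVec_mulVec]
  refine Finset.sum_nonneg fun x _ => Finset.sum_nonneg fun a _ => ?_
  rw [dotProduct_comm (M.feature x a)]
  exact mul_nonneg (by positivity) (mul_self_nonneg _)

/-- Without its reward a round carries no information about the parameter. -/
lemma map_forget_reward_roundLaw (θ μ : Fin d → ℝ) :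
    (M.roundLaw θ).map (fun z => ((z.1, z.2.1, 0) : Round C K)) =
      (M.roundLaw μ).map (fun z => ((z.1, z.2.1, 0) : Round C K)) := by
  have hm : Measurable fun z : Round C K => ((z.1, z.2.1, 0) : Round C K) := by fun_prop
  ext s hs
  rw [Measure.map_apply hm hs, Measure.map_apply hm hs, M.roundLaw_apply _ (hm hs),
    M.roundLaw_apply _ (hm hs)]
  refine Finset.sum_congr rfl fun x _ => Finset.sum_congr rfl fun a _ => ?_
  -- With the reward erased, the slice at `(x, a)` is everything or empty, so its Gaussian mass is
  -- `1` or `0` whatever the mean.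
  by_cases h : ((x, a, 0) : Round C K) ∈ s <;> simp [h]

/-- Shift the reward by its mean under `θ`. -/
noncomputable def shift (θ : Fin d → ℝ) (z : Round C K) : Round C K :=
  (z.1, z.2.1, z.2.2 + θ ⬝ᵥ M.feature z.1 z.2.1)

lemma measurable_shift (θ : Fin d → ℝ) : Measurable (M.shift θ) :=
  measurable_of_contexts_arms fun x a => by simp only [shift]; fun_prop

/-- The parameter enters a round only as a translation of the reward; this reduces statements about
all `θ` to the noise law at `0`. -/
lemma map_shift_roundLaw (θ : Fin d → ℝ) : (M.roundLaw 0).map (M.shift θ) = M.roundLaw θ := by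
  have hm := M.measurable_shift θ
  ext s hs
  rw [Measure.map_apply hm hs, M.roundLaw_apply _ (hm hs), M.roundLaw_apply _ hs]
  refine Finset.sum_congr rfl fun x _ => Finset.sum_congr rfl fun a _ => ?_
  have h := gaussianReal_map_add_const (μ := 0) (v := 1) (θ ⬝ᵥ M.feature x a)
  rw [zero_add] at h
  have hs' : MeasurableSet {r : ℝ | ((x, a, r) : Round C K) ∈ s} := measurable_mk x a hs
  rw [zero_dotProduct, ← h, Measure.map_apply (by fun_prop) hs']
  rfl

end PassiveModel

/-! ### Stopping times and the tail-sum formula for their expectation. -/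

lemma toENNReal_eq_tsum (n : WithTop ℕ) :
    ENat.toENNReal n = ∑' s : ℕ, if (s : WithTop ℕ) < n then (1 : ℝ≥0∞) else 0 := by
  cases n with
  | top =>
    have h : ∀ s : ℕ, (s : WithTop ℕ) < ⊤ := WithTop.coe_lt_top
    simp only [h, if_true, ENNReal.tsum_const, ENat.card_eq_top_of_infinite, mul_one]
    rfl
  | coe n =>
    rw [tsum_eq_sum (s := Finset.range n)]
    · rw [Finset.sum_congr rfl (g := fun _ => 1) fun s hs => if_pos (by simpa using hs)]
      simp
      exact ENat.toENNReal_coe n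
    · intro s hs
      exact if_neg (by simpa using hs)

section StoppingTimes

variable {Ω : Type*} {m : MeasurableSpace Ω} {f : Filtration ℕ m} {σ : Ω → WithTop ℕ}

lemma measurableSet_coe_lt (hσ : IsStoppingTime f σ) (s : ℕ) :
    MeasurableSet[f s] {ω | (s : WithTop ℕ) < σ ω} := by
  have h := (hσ s).compl
  convert h using 1
  ext ω
  simp

lemma measurableSet_lt_top (hσ : IsStoppingTime f σ) : MeasurableSet {ω | σ ω < ⊤} := by
  have h : {ω | σ ω < ⊤} = ⋃ n : ℕ, {ω | σ ω ≤ (n : WithTop ℕ)} := by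
    ext ω
    simp only [Set.mem_ofPred_eq, Set.mem_iUnion]
    constructor
    · intro h
      lift σ ω to ℕ using h.ne with n
      exact ⟨n, le_rfl⟩
    · rintro ⟨n, hn⟩
      exact hn.trans_lt (WithTop.coe_lt_top n)
  rw [h]
  exact MeasurableSet.iUnion fun n => f.le n _ (hσ n)

lemma measurable_untopD (hσ : IsStoppingTime f σ) : Measurable fun ω => (σ ω).untopD 0 := by
  refine measurable_of_Iic fun n => ?_
  have h : (fun ω => (σ ω).untopD 0) ⁻¹' Set.Iic n =
      {ω | σ ω ≤ (n : WithTop ℕ)} ∪ {ω | σ ω < ⊤}ᶜ := by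
    ext ω
    simp only [Set.mem_preimage, Set.mem_Iic, Set.mem_union, Set.mem_ofPred_eq, Set.mem_compl_iff]
    cases σ ω with
    | top => simp
    | coe n => simp; rfl
  rw [h]
  exact (f.le n _ (hσ n)).union (measurableSet_lt_top hσ).compl

lemma lintegral_toENNReal_eq_tsum (hσ : IsStoppingTime f σ) (P : Measure Ω) :
    ∫⁻ ω, ENat.toENNReal (σ ω) ∂P = ∑' s : ℕ, P {ω | (s : WithTop ℕ) < σ ω} := by
  simp_rw [toENNReal_eq_tsum]
  rw [lintegral_tsum]
  · congr with s
    rw [← lintegral_indicator_one (f.le s _ (measurableSet_coe_lt hσ s))]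
    refine lintegral_congr fun ω => ?_
    by_cases h : (s : WithTop ℕ) < σ ω <;> simp [h]
  · intro s
    exact (Measurable.ite (f.le s _ (measurableSet_coe_lt hσ s)) measurable_const
      measurable_const).aemeasurable

lemma ae_lt_top_of_lintegral_ne_top (hσ : IsStoppingTime f σ) {P : Measure Ω}
    (h : ∫⁻ ω, ENat.toENNReal (σ ω) ∂P ≠ ⊤) : ∀ᵐ ω ∂P, σ ω < ⊤ := by
  have hm : Measurable fun ω => ENat.toENNReal (σ ω) := by
    simp_rw [toENNReal_eq_tsum]
    exact Measurable.tsum fun s => Measurable.ite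
      (f.le s _ (measurableSet_coe_lt hσ s)) measurable_const measurable_const
  filter_upwards [ae_lt_top hm h] with ω hω
  exact ENat.toENNReal_lt_top.1 hω

end StoppingTimes

/-! ### Likelihood ratios on histories. -/

namespace PassiveModel

variable {d C K : ℕ} (M : PassiveModel d C K)

instance isProbabilityMeasure_law (θ : Fin d → ℝ) : IsProbabilityMeasure (M.law θ) := by
  unfold law; infer_instance

/-- The law under which the first `t` rounds follow `μ`, the others `θ`. -/
lemma infinitePi_ite_eq_withDensity (θ μ : Fin d → ℝ) (t : ℕ) :
    Measure.infinitePi (fun s : ℕ => M.roundLaw (if s < t then μ else θ)) =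
      (M.law θ).withDensity
        (fun ω => ENNReal.ofReal (Real.exp (-∑ s ∈ Finset.range t, M.logRatio θ μ (ω s)))) := by
  symm
  refine Measure.eq_infinitePi _ fun S T hT => ?_
  set l : Round C K → ℝ≥0∞ := fun z => ENNReal.ofReal (Real.exp (-M.logRatio θ μ z)) with hl
  have hlm : Measurable l :=
    (Real.measurable_exp.comp (M.measurable_logRatio θ μ).neg).ennreal_ofReal
  have hpi : MeasurableSet (Set.pi (S : Set ℕ) T) :=
    MeasurableSet.pi S.countable_toSet fun i _ => hT i
  -- Indicator and density both factor over rounds; the factors are nontrivial only on `S ∪ range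
  -- t`, and by `hmass` those outside `S` integrate to `1`.
  set g : ℕ → Round C K → ℝ≥0∞ := fun i z =>
    (if i ∈ S then (T i).indicator 1 z else 1) * (if i < t then l z else 1) with hg
  have hgm : ∀ i, Measurable (g i) := fun i => by
    refine Measurable.mul ?_ ?_
    · split_ifs
      · exact measurable_one.indicator (hT i)
      · exact measurable_const
    · split_ifs
      · exact hlm
      · exact measurable_const
  have hint : ∀ i, ∫⁻ z, g i z ∂(M.roundLaw θ) =
      if i ∈ S then M.roundLaw (if i < t then μ else θ) (T i) else 1 := by
    intro i
    have hmass : ∫⁻ z, l z ∂(M.roundLaw θ) = 1 := by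
      have h := measure_univ (μ := M.roundLaw μ)
      rwa [M.roundLaw_eq_withDensity θ μ, withDensity_apply _ MeasurableSet.univ,
        setLIntegral_univ] at h
    by_cases hS : i ∈ S <;> by_cases ht : i < t <;> simp only [hg, hS, ht, if_true, if_false,
      one_mul, mul_one]
    · rw [M.roundLaw_eq_withDensity θ μ, withDensity_apply _ (hT i), ← lintegral_indicator (hT i)]
      congr with z
      by_cases hz : z ∈ T i <;> simp [hz, hl]
    · exact lintegral_indicator_one (hT i)
    · exact hmass
    · simp
  have hind : iIndepFun (fun i (ω : History C K) => g i (ω i)) (M.law θ) :=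
    iIndepFun_infinitePi hgm
  have hprod : ∀ ω : History C K, (Set.pi (S : Set ℕ) T).indicator
      (fun ω => ENNReal.ofReal (Real.exp (-∑ s ∈ Finset.range t, M.logRatio θ μ (ω s)))) ω =
      ∏ i ∈ S ∪ Finset.range t, g i (ω i) := by
    intro ω
    simp only [hg]
    rw [Finset.prod_mul_distrib]
    have h1 : ∏ i ∈ S ∪ Finset.range t, (if i ∈ S then (T i).indicator 1 (ω i) else 1) =
        (Set.pi (S : Set ℕ) T).indicator (1 : History C K → ℝ≥0∞) ω := by
      rw [Finset.prod_ite_mem, Finset.union_inter_cancel_left]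
      by_cases hω : ω ∈ Set.pi (S : Set ℕ) T
      · rw [Set.indicator_of_mem hω]
        exact Finset.prod_eq_one fun i hi => Set.indicator_of_mem (hω i hi) _
      · rw [Set.indicator_of_notMem hω]
        simp only [Set.mem_pi, not_forall] at hω
        obtain ⟨i, hi, hiT⟩ := hω
        exact Finset.prod_eq_zero hi (Set.indicator_of_notMem hiT _)
    have h2 : ∏ i ∈ S ∪ Finset.range t, (if i < t then l (ω i) else 1) =
        ENNReal.ofReal (Real.exp (-∑ s ∈ Finset.range t, M.logRatio θ μ (ω s))) := by
      simp only [← Finset.mem_range]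
      rw [Finset.prod_ite_mem, Finset.union_inter_cancel_right, ← Finset.sum_neg_distrib,
        Real.exp_sum, ENNReal.ofReal_prod_of_nonneg fun _ _ => (Real.exp_pos _).le]
    rw [h1, h2]
    by_cases hω : ω ∈ Set.pi (S : Set ℕ) T <;> simp [hω]
  rw [withDensity_apply _ hpi, ← lintegral_indicator hpi, lintegral_congr hprod,
    lintegral_prod_eq_prod_lintegral_of_indepFun _ _ hind
      (fun i => (hgm i).comp (measurable_pi_apply i))]
  have heval : ∀ i, ∫⁻ ω : History C K, g i (ω i) ∂(M.law θ) = ∫⁻ z, g i z ∂(M.roundLaw θ) := by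
    intro i
    rw [← Measure.infinitePi_map_eval (fun _ : ℕ => M.roundLaw θ) i,
      lintegral_map (hgm i) (measurable_pi_apply i)]
    rfl
  simp only [heval, hint]
  rw [Finset.prod_ite_mem, Finset.union_inter_cancel_left]

/-- On the information available at time `t` the law of `μ` has a density with respect to the law
of `θ`; the context of round `t + 1` does not contribute. -/
lemma law_apply_of_measurableSet_info (θ μ : Fin d → ℝ) (t : ℕ) {B : Set (History C K)}
    (hB : MeasurableSet[infoFiltration C K t] B) :
    M.law μ B = ∫⁻ ω in B,
      ENNReal.ofReal (Real.exp (-∑ s ∈ Finset.range t, M.logRatio θ μ (ω s))) ∂(M.law θ) := by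
  rw [← withDensity_apply _ ((infoFiltration C K).le t _ hB), ← infinitePi_ite_eq_withDensity]
  -- The map `F` erases all rewards from index `t` on. Events known at `t` factor through `F`, and
  -- the law of `μ` and the hybrid law have the same image under it.
  let f : ℕ → Round C K → Round C K := fun s z => if s < t then z else (z.1, z.2.1, 0)
  have hf : ∀ s, Measurable (f s) := fun s => by
    by_cases h : s < t <;> simp only [f, h, if_true, if_false] <;> fun_prop
  let F : History C K → History C K := fun ω s => f s (ω s)
  have hF : Measurable F := measurable_pi_lambda _ fun s => (hf s).comp (measurable_pi_apply s)
  have hle : infoFiltration C K t ≤ MeasurableSpace.comap F inferInstance := by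
    refine sup_le (iSup_le fun s => ?_) ?_
    · rintro _ ⟨T, hT, rfl⟩
      refine ⟨(fun ω : History C K => ω s) ⁻¹' T, measurable_pi_apply _ hT, ?_⟩
      ext ω
      simp [F, f]
    · rintro _ ⟨T, hT, rfl⟩
      refine ⟨(fun ω : History C K => (ω t).1) ⁻¹' T,
        (measurable_fst.comp (measurable_pi_apply t)) hT, ?_⟩
      ext ω
      simp [F, f]
  obtain ⟨B', hB', rfl⟩ := hle B hB
  rw [← Measure.map_apply hF hB', ← Measure.map_apply hF hB', law,
    Measure.infinitePi_map_pi _ hf, Measure.infinitePi_map_pi _ hf]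
  congr 2
  ext1 s
  by_cases h : s < t
  · simp [h]
  · simp only [f, h, if_false]
    exact M.map_forget_reward_roundLaw μ θ

/-! ### Independence of past and present, and Wald's identity. -/

lemma indep_dataSigma_round (θ : Fin d → ℝ) (s : ℕ) :
    Indep (dataSigma C K s)
      (MeasurableSpace.comap (fun ω : History C K => ω s) inferInstance) (M.law θ) := by
  have h : iIndepFun (fun i (ω : History C K) => ω i) (M.law θ) :=
    iIndepFun_infinitePi (X := fun _ z => z) fun _ => measurable_id
  have h' := indep_iSup_of_disjoint (fun i => (measurable_pi_apply i).comap_le) h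
    (S := Set.Iio s) (T := {s}) (by simp)
  refine indep_of_indep_of_le_right (indep_of_indep_of_le_left h' ?_) ?_
  · exact iSup_le fun i => le_iSup₂ (f := fun (i : ℕ) (_ : i ∈ Set.Iio s) =>
      MeasurableSpace.comap (fun ω : History C K => ω i) inferInstance) (i : ℕ) i.2
  · exact le_iSup₂ (f := fun (i : ℕ) (_ : i ∈ ({s} : Set ℕ)) =>
      MeasurableSpace.comap (fun ω : History C K => ω i) inferInstance) s rfl

variable {σ : History C K → WithTop ℕ}

/-- The event `s < σ` depends on `ω 0, …, ω (s - 1)` only, hence is independent of `ω s`. This is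
where `σ` must not look at the coming context. -/
lemma integral_indicator_round (θ : Fin d → ℝ) (hσ : IsStoppingTime (dataFiltration C K) σ)
    {g : Round C K → ℝ} (hg : Measurable g) (s : ℕ) :
    ∫ ω, {ω | (s : WithTop ℕ) < σ ω}.indicator (fun ω => g (ω s)) ω ∂(M.law θ) =
      (M.law θ {ω | (s : WithTop ℕ) < σ ω}).toReal * ∫ z, g z ∂(M.roundLaw θ) := by
  have hA := measurableSet_coe_lt hσ s
  have hA' := (dataFiltration C K).le s _ hA
  have hX : Measurable[dataSigma C K s]
      ({ω | (s : WithTop ℕ) < σ ω}.indicator (1 : History C K → ℝ)) :=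
    (@measurable_const _ _ _ (dataSigma C K s) 1).indicator hA
  have hgs : Measurable fun ω : History C K => g (ω s) := hg.comp (measurable_pi_apply s)
  have hind : IndepFun ({ω | (s : WithTop ℕ) < σ ω}.indicator (1 : History C K → ℝ))
      (fun ω => g (ω s)) (M.law θ) := by
    refine indep_of_indep_of_le_right
      (indep_of_indep_of_le_left (M.indep_dataSigma_round θ s) hX.comap_le) ?_
    rintro _ ⟨T, hT, rfl⟩
    exact ⟨g ⁻¹' T, hg hT, rfl⟩
  have h := hind.integral_fun_mul_eq_mul_integral
    (measurable_one.indicator hA').aestronglyMeasurable hgs.aestronglyMeasurable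
  rw [integral_indicator_one hA'] at h
  have he : ∫ ω, g (ω s) ∂(M.law θ) = ∫ z, g z ∂(M.roundLaw θ) := by
    rw [← Measure.infinitePi_map_eval (fun _ : ℕ => M.roundLaw θ) s,
      integral_map (measurable_pi_apply s).aemeasurable hg.aestronglyMeasurable]
    rfl
  rw [he] at h
  rw [← measureReal_def, ← h]
  congr with ω
  by_cases hω : (s : WithTop ℕ) < σ ω <;> simp [hω]

lemma integrable_indicator_round (θ : Fin d → ℝ) (hσ : IsStoppingTime (dataFiltration C K) σ)
    {g : Round C K → ℝ} (hg : Integrable g (M.roundLaw θ)) (s : ℕ) :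
    Integrable ({ω | (s : WithTop ℕ) < σ ω}.indicator (fun ω => g (ω s))) (M.law θ) := by
  refine Integrable.indicator ?_ ((dataFiltration C K).le s _ (measurableSet_coe_lt hσ s))
  exact (measurePreserving_eval_infinitePi
    (fun _ : ℕ => M.roundLaw θ) s).integrable_comp_of_integrable hg

lemma hasSum_indicator_round {g : Round C K → ℝ} {ω : History C K} (h : σ ω < ⊤) :
    HasSum (fun s : ℕ => {ω | (s : WithTop ℕ) < σ ω}.indicator (fun ω => g (ω s)) ω)
      (∑ s ∈ Finset.range ((σ ω).untopD 0), g (ω s)) := by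
  have h0 : ∀ s : ℕ, s ∈ Finset.range ((σ ω).untopD 0) ↔ (s : WithTop ℕ) < σ ω := by
    intro s
    lift σ ω to ℕ using h.ne with n
    simp only [Finset.mem_range]
    exact Iff.trans Iff.rfl WithTop.coe_lt_coe.symm
  have h1 : ∑ s ∈ Finset.range ((σ ω).untopD 0), g (ω s) =
      ∑ s ∈ Finset.range ((σ ω).untopD 0),
        {ω | (s : WithTop ℕ) < σ ω}.indicator (fun ω => g (ω s)) ω :=
    Finset.sum_congr rfl fun s hs => by rw [Set.indicator_of_mem]; exact (h0 s).1 hs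
  rw [h1]
  refine hasSum_sum_of_ne_finset_zero fun s hs => ?_
  rw [h0] at hs
  exact Set.indicator_of_notMem (s := {ω | (s : WithTop ℕ) < σ ω}) hs _

lemma summable_integral_norm_indicator_round (θ : Fin d → ℝ)
    (hσ : IsStoppingTime (dataFiltration C K) σ)
    (hfin : ∫⁻ ω, ENat.toENNReal (σ ω) ∂(M.law θ) ≠ ⊤) {g : Round C K → ℝ} (hg : Measurable g) :
    Summable fun s : ℕ =>
      ∫ ω, ‖{ω | (s : WithTop ℕ) < σ ω}.indicator (fun ω => g (ω s)) ω‖ ∂(M.law θ) := by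
  simp only [norm_indicator_eq_indicator_norm]
  simp only [M.integral_indicator_round θ hσ hg.norm]
  rw [lintegral_toENNReal_eq_tsum hσ] at hfin
  exact (ENNReal.summable_toReal hfin).mul_right _

/-- Wald's identity. -/
lemma integral_stopped_sum (θ : Fin d → ℝ) (hσ : IsStoppingTime (dataFiltration C K) σ)
    (hfin : ∫⁻ ω, ENat.toENNReal (σ ω) ∂(M.law θ) ≠ ⊤) {g : Round C K → ℝ} (hg : Measurable g)
    (hgi : Integrable g (M.roundLaw θ)) :
    ∫ ω, ∑ s ∈ Finset.range ((σ ω).untopD 0), g (ω s) ∂(M.law θ) =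
      (∫⁻ ω, ENat.toENNReal (σ ω) ∂(M.law θ)).toReal * ∫ z, g z ∂(M.roundLaw θ) := by
  -- The stopped sum is the series of `g (ω s)` restricted to `s < σ`. Integrating termwise leaves
  -- the sum of the probabilities of `s < σ`, which is the expectation of `σ`.
  have hsum := hasSum_integral_of_summable_integral_norm
    (fun s => M.integrable_indicator_round θ hσ hgi s)
    (M.summable_integral_norm_indicator_round θ hσ hfin hg)
  have hae : (fun ω => ∑' s : ℕ, {ω | (s : WithTop ℕ) < σ ω}.indicator (fun ω => g (ω s)) ω)
      =ᵐ[M.law θ] fun ω => ∑ s ∈ Finset.range ((σ ω).untopD 0), g (ω s) := by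
    filter_upwards [ae_lt_top_of_lintegral_ne_top hσ hfin] with ω hω
    exact (hasSum_indicator_round hω).tsum_eq
  rw [integral_congr_ae hae] at hsum
  rw [← hsum.tsum_eq]
  simp only [M.integral_indicator_round θ hσ hg]
  rw [tsum_mul_right, lintegral_toENNReal_eq_tsum hσ, ENNReal.tsum_toReal_eq]
  exact fun s => measure_ne_top _ _

lemma measurable_stopped_sum (hσ : IsStoppingTime (dataFiltration C K) σ) {g : Round C K → ℝ}
    (hg : Measurable g) :
    Measurable fun ω : History C K => ∑ s ∈ Finset.range ((σ ω).untopD 0), g (ω s) := by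
  have h : Measurable fun p : ℕ × History C K => ∑ s ∈ Finset.range p.1, g (p.2 s) :=
    measurable_from_prod_countable_right fun n =>
      Finset.measurable_fun_sum (Finset.range n) fun s _ => hg.comp (measurable_pi_apply s)
  exact h.comp ((measurable_untopD hσ).prodMk measurable_id)

lemma integrable_stopped_sum (θ : Fin d → ℝ) (hσ : IsStoppingTime (dataFiltration C K) σ)
    (hfin : ∫⁻ ω, ENat.toENNReal (σ ω) ∂(M.law θ) ≠ ⊤) {g : Round C K → ℝ} (hg : Measurable g)
    (hgi : Integrable g (M.roundLaw θ)) :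
    Integrable (fun ω => ∑ s ∈ Finset.range ((σ ω).untopD 0), g (ω s)) (M.law θ) := by
  refine ⟨(measurable_stopped_sum hσ hg).aestronglyMeasurable, ?_⟩
  have hi := fun s => M.integrable_indicator_round θ hσ hgi s
  calc ∫⁻ ω, ‖∑ s ∈ Finset.range ((σ ω).untopD 0), g (ω s)‖ₑ ∂(M.law θ)
      ≤ ∫⁻ ω, ∑' s : ℕ, ‖{ω | (s : WithTop ℕ) < σ ω}.indicator (fun ω => g (ω s)) ω‖ₑ
          ∂(M.law θ) := by
        refine lintegral_mono_ae ?_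
        filter_upwards [ae_lt_top_of_lintegral_ne_top hσ hfin] with ω hω
        rw [← (hasSum_indicator_round hω).tsum_eq]
        exact enorm_tsum_le_tsum_enorm
    _ = ∑' s : ℕ, ENNReal.ofReal
          (∫ ω, ‖{ω | (s : WithTop ℕ) < σ ω}.indicator (fun ω => g (ω s)) ω‖ ∂(M.law θ)) := by
        rw [lintegral_tsum fun s => (hi s).aestronglyMeasurable.enorm]
        congr with s
        rw [ofReal_integral_norm_eq_lintegral_enorm (hi s)]
    _ < ⊤ := by
        rw [← ENNReal.ofReal_tsum_of_nonneg
          (fun s => integral_nonneg fun _ => norm_nonneg _)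
          (M.summable_integral_norm_indicator_round θ hσ hfin hg)]
        exact ENNReal.ofReal_lt_top

/-! ### Change of measure at a stopping time. -/

lemma setLIntegral_stopped_likelihood_le (θ μ : Fin d → ℝ)
    (hσ : IsStoppingTime (dataFiltration C K) σ)
    (hfin : ∫⁻ ω, ENat.toENNReal (σ ω) ∂(M.law θ) ≠ ⊤) {E : Set (History C K)}
    (hEt : ∀ t : ℕ, MeasurableSet[infoFiltration C K t] (E ∩ {ω | σ ω = t})) :
    ∫⁻ ω in E, ENNReal.ofReal
      (Real.exp (-∑ s ∈ Finset.range ((σ ω).untopD 0), M.logRatio θ μ (ω s))) ∂(M.law θ) ≤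
      M.law μ E := by
  have hsub : (⋃ t : ℕ, E ∩ {ω | σ ω = t}) ⊆ E := Set.iUnion_subset fun t => Set.inter_subset_left
  have hEt' : ∀ t : ℕ, MeasurableSet (E ∩ {ω | σ ω = t}) :=
    fun t => (infoFiltration C K).le t _ (hEt t)
  have hdisj : Pairwise (Function.onFun Disjoint fun t : ℕ => E ∩ {ω | σ ω = (t : WithTop ℕ)}) := by
    intro i j hij
    refine Set.disjoint_left.2 fun ω hi hj => hij ?_
    have := hi.2.symm.trans hj.2
    exact WithTop.coe_injective this
  have hae : E =ᵐ[M.law θ] ⋃ t : ℕ, E ∩ {ω | σ ω = t} := by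
    refine Filter.eventuallyEq_set.2 ?_
    filter_upwards [ae_lt_top_of_lintegral_ne_top hσ hfin] with ω hω
    refine ⟨fun h => ?_, fun h => hsub h⟩
    exact Set.mem_iUnion.2 ⟨(σ ω).untop hω.ne, h, (WithTop.coe_untop _ hω.ne).symm⟩
  rw [setLIntegral_congr hae, lintegral_iUnion hEt' hdisj]
  -- Only an inequality: the event `σ = ⊤` is null under `θ` but may have mass under `μ`.
  refine le_trans ?_ (measure_mono hsub)
  rw [measure_iUnion hdisj hEt']
  refine ENNReal.tsum_le_tsum fun t => ?_
  rw [M.law_apply_of_measurableSet_info θ μ t (hEt t)]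
  refine (setLIntegral_congr_fun (hEt' t) fun ω hω => ?_).le
  have : σ ω = t := hω.2
  simp only [this]
  rfl

/-- The change-of-measure inequality, in the form of Donsker and Varadhan: for an event that is
known when `σ` stops, the divergence of the laws of `θ` and `μ` up to `σ` is at least that of its
indicator. -/
theorem change_of_measure (θ μ : Fin d → ℝ) (hσ : IsStoppingTime (dataFiltration C K) σ)
    (hfin : ∫⁻ ω, ENat.toENNReal (σ ω) ∂(M.law θ) ≠ ⊤) {E : Set (History C K)}
    (hE : MeasurableSet E)
    (hEt : ∀ t : ℕ, MeasurableSet[infoFiltration C K t] (E ∩ {ω | σ ω = t})) (a b : ℝ) :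
    a * (M.law θ).real E + b * (1 - (M.law θ).real E) ≤
      Real.exp a * (M.law μ).real E + Real.exp b * (1 - (M.law μ).real E) - 1 +
        (∫⁻ ω, ENat.toENNReal (σ ω) ∂(M.law θ)).toReal *
          (1 / 2 * ((μ - θ) ⬝ᵥ M.designMatrix.mulVec (μ - θ))) := by
  classical
  have hlm := M.measurable_logRatio θ μ
  have hli := M.integrable_logRatio θ μ
  -- Where `σ = ⊤` the default of `untopD` makes this the empty sum; by `hfin` that event is null
  -- under `θ`.
  set S : History C K → ℝ := fun ω =>
    ∑ s ∈ Finset.range ((σ ω).untopD 0), M.logRatio θ μ (ω s) with hS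
  have hSm : Measurable S := measurable_stopped_sum hσ hlm
  have hSi : Integrable S (M.law θ) := M.integrable_stopped_sum θ hσ hfin hlm hli
  have hSint : ∫ ω, S ω ∂(M.law θ) = (∫⁻ ω, ENat.toENNReal (σ ω) ∂(M.law θ)).toReal *
      (1 / 2 * ((μ - θ) ⬝ᵥ M.designMatrix.mulVec (μ - θ))) := by
    rw [← M.integral_logRatio θ μ]
    exact M.integral_stopped_sum θ hσ hfin hlm hli
  have hEt_compl : ∀ t : ℕ, MeasurableSet[infoFiltration C K t] (Eᶜ ∩ {ω | σ ω = t}) := by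
    intro t
    have h1 : MeasurableSet[infoFiltration C K t] {ω | σ ω = t} :=
      le_sup_left (a := dataSigma C K t) _ (hσ.measurableSet_eq t)
    have h2 : Eᶜ ∩ {ω | σ ω = t} = {ω | σ ω = t} \ (E ∩ {ω | σ ω = t}) := by
      ext ω; simp; tauto
    rw [h2]
    exact h1.diff (hEt t)
  have hpart : ∀ (c : ℝ) (A : Set (History C K)), MeasurableSet A →
      (∀ t : ℕ, MeasurableSet[infoFiltration C K t] (A ∩ {ω | σ ω = t})) →
      IntegrableOn (fun ω => Real.exp (c - S ω)) A (M.law θ) ∧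
      ∫ ω in A, Real.exp (c - S ω) ∂(M.law θ) ≤ Real.exp c * (M.law μ).real A := by
    intro c A hA hAt
    have hle := M.setLIntegral_stopped_likelihood_le θ μ hσ hfin hAt
    have hm : Measurable fun ω => Real.exp (c - S ω) := by fun_prop
    have hl : ∫⁻ ω in A, ENNReal.ofReal (Real.exp (c - S ω)) ∂(M.law θ) ≤
        ENNReal.ofReal (Real.exp c) * M.law μ A := by
      simp only [sub_eq_add_neg, Real.exp_add, ENNReal.ofReal_mul (Real.exp_pos c).le]
      rw [lintegral_const_mul _ (by fun_prop)]
      gcongr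
    refine ⟨⟨hm.aestronglyMeasurable, ?_⟩, ?_⟩
    · rw [hasFiniteIntegral_iff_ofReal (Filter.Eventually.of_forall fun _ => (Real.exp_pos _).le)]
      exact hl.trans_lt (ENNReal.mul_lt_top ENNReal.ofReal_lt_top (measure_lt_top _ _))
    · rw [integral_eq_lintegral_of_nonneg_ae
        (Filter.Eventually.of_forall fun _ => (Real.exp_pos _).le) hm.aestronglyMeasurable]
      refine (ENNReal.toReal_mono
        (ENNReal.mul_ne_top ENNReal.ofReal_ne_top (measure_ne_top _ _)) hl).trans ?_
      rw [ENNReal.toReal_mul, ENNReal.toReal_ofReal (Real.exp_pos c).le, measureReal_def]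
  obtain ⟨hi1, hle1⟩ := hpart a E hE hEt
  obtain ⟨hi2, hle2⟩ := hpart b Eᶜ hE.compl hEt_compl
  have hlog : ∀ (c : ℝ) (A : Set (History C K)),
      IntegrableOn (fun ω => Real.exp (c - S ω)) A (M.law θ) →
      c * (M.law θ).real A - ∫ ω in A, S ω ∂(M.law θ) ≤
        ∫ ω in A, Real.exp (c - S ω) ∂(M.law θ) - (M.law θ).real A := by
    intro c A hi
    -- Integrates `y + 1 ≤ exp y` at `y = c - S`. The cases `c = a` on `E` and `c = b` on `Eᶜ` add
    -- up to the claim.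
    have h := integral_mono (μ := (M.law θ).restrict A)
      ((integrable_const c).sub hSi.integrableOn) (hi.sub (integrable_const (1 : ℝ)))
      (fun ω => by
        have := Real.add_one_le_exp (c - S ω)
        simp only [Pi.sub_apply]
        linarith)
    simp only [Pi.sub_apply] at h
    rw [integral_sub (integrable_const c) hSi.integrableOn,
      integral_sub hi (integrable_const (1 : ℝ))] at h
    simpa [mul_comm] using h
  have h1 := hlog a E hi1
  have h2 := hlog b Eᶜ hi2
  have h3 := integral_add_compl hE hSi
  rw [probReal_compl_eq_one_sub hE] at h2 hle2
  linarith

end PassiveModel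

/-! ### Delaying the stopping time by one round. -/

lemma infoFiltration_le_dataFiltration_succ (C K t : ℕ) :
    infoFiltration C K t ≤ dataFiltration C K (t + 1) := by
  refine sup_le ((dataFiltration C K).mono t.le_succ) ?_
  refine le_trans ?_ (le_iSup (fun r : Fin (t + 1) =>
    MeasurableSpace.comap (fun ω : History C K => ω r) inferInstance) (Fin.last t))
  rintro _ ⟨s, hs, rfl⟩
  exact ⟨Prod.fst ⁻¹' s, measurable_fst hs, rfl⟩

lemma withTop_add_one_le (n : WithTop ℕ) (u : ℕ) :
    n + 1 ≤ ((u + 1 : ℕ) : WithTop ℕ) ↔ n ≤ (u : WithTop ℕ) := by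
  have h : ((u + 1 : ℕ) : WithTop ℕ) = (u : WithTop ℕ) + 1 := rfl
  rw [h]
  exact WithTop.add_le_add_iff_right WithTop.one_ne_top

lemma withTop_add_one_eq (n : WithTop ℕ) (u : ℕ) :
    n + 1 = ((u + 1 : ℕ) : WithTop ℕ) ↔ n = (u : WithTop ℕ) := by
  have h : ((u + 1 : ℕ) : WithTop ℕ) = (u : WithTop ℕ) + 1 := rfl
  rw [h]
  exact WithTop.add_right_inj WithTop.one_ne_top

lemma toENNReal_withTop_add_one (n : WithTop ℕ) :
    ENat.toENNReal (n + 1 : WithTop ℕ) = ENat.toENNReal n + 1 :=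
  (ENat.toENNReal_add n (1 : ℕ∞)).trans (congrArg _ ENat.toENNReal_one)

namespace PassiveAlgorithm

variable {C K : ℕ} (alg : PassiveAlgorithm C K)

lemma measurableSet_recommend (A : Set (Fin C → Fin K)) : MeasurableSet (alg.recommend ⁻¹' A) :=
  alg.isStoppingTime.measurableSpace_le _
    (alg.measurable_recommend (MeasurableSet.of_discrete (s := A)))

lemma measurableSet_recommend_inter_eq (A : Set (Fin C → Fin K)) (t : ℕ) :
    MeasurableSet[infoFiltration C K t]
      (alg.recommend ⁻¹' A ∩ {ω | alg.stoppingTime ω = (t : WithTop ℕ)}) := by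
  have h : MeasurableSet[infoFiltration C K t]
      (alg.recommend ⁻¹' A ∩ {ω | alg.stoppingTime ω ≤ (t : WithTop ℕ)}) :=
    (alg.measurable_recommend (MeasurableSet.of_discrete (s := A))).2 t
  have h2 := h.inter (alg.isStoppingTime.measurableSet_eq t)
  convert h2 using 1
  ext ω
  simp only [Set.mem_inter_iff, Set.mem_preimage, Set.mem_ofPred_eq]
  constructor
  · rintro ⟨h1, h2⟩
    exact ⟨⟨h1, h2.le⟩, h2⟩
  · rintro ⟨⟨h1, -⟩, h2⟩
    exact ⟨h1, h2⟩

/-- One round later everything the algorithm used is data. -/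
lemma isStoppingTime_add_one :
    IsStoppingTime (dataFiltration C K) fun ω => alg.stoppingTime ω + 1 := by
  intro i
  cases i with
  | zero =>
    have h : {ω | alg.stoppingTime ω + 1 ≤ ((0 : ℕ) : WithTop ℕ)} = ∅ := by
      ext ω
      cases alg.stoppingTime ω with
      | top => simp
      | coe n => simp
    refine MeasurableSet.congr ?_ h.symm
    exact @MeasurableSet.empty _ (dataFiltration C K 0)
  | succ u =>
    have h : {ω | alg.stoppingTime ω + 1 ≤ ((u + 1 : ℕ) : WithTop ℕ)} =
        {ω | alg.stoppingTime ω ≤ (u : WithTop ℕ)} := by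
      ext ω
      exact withTop_add_one_le _ u
    exact h ▸ infoFiltration_le_dataFiltration_succ C K u _ (alg.isStoppingTime u)

lemma measurableSet_recommend_inter_add_one_eq (A : Set (Fin C → Fin K)) (t : ℕ) :
    MeasurableSet[infoFiltration C K t]
      (alg.recommend ⁻¹' A ∩ {ω | alg.stoppingTime ω + 1 = (t : WithTop ℕ)}) := by
  cases t with
  | zero =>
    have h : alg.recommend ⁻¹' A ∩ {ω | alg.stoppingTime ω + 1 = ((0 : ℕ) : WithTop ℕ)} = ∅ := by
      ext ω
      cases alg.stoppingTime ω with
      | top => simp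
      | coe n => simp
    rw [h]
    exact @MeasurableSet.empty _ (infoFiltration C K 0)
  | succ u =>
    have h : {ω | alg.stoppingTime ω + 1 = ((u + 1 : ℕ) : WithTop ℕ)} =
        {ω | alg.stoppingTime ω = (u : WithTop ℕ)} := by
      ext ω
      exact withTop_add_one_eq _ u
    rw [h]
    exact (infoFiltration C K).mono u.le_succ _ (alg.measurableSet_recommend_inter_eq A u)

end PassiveAlgorithm

lemma bernoulliKL_symm {δ : ℝ} :
    bernoulliKL δ (1 - δ) = (1 - 2 * δ) * Real.log ((1 - δ) / δ) := by
  rw [bernoulliKL, sub_sub_cancel, ← inv_div (1 - δ) δ, Real.log_inv]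
  ring

/-! ### From the PAC property to the lower bound. -/

namespace PassiveModel

variable {d C K : ℕ} (M : PassiveModel d C K)

lemma gap_nonneg (θ : Fin d → ℝ) (x : Fin C) (a : Fin K) : 0 ≤ M.gap θ x a :=
  sub_nonneg.2 (le_ciSup (f := fun b => θ ⬝ᵥ M.feature x b) (Set.finite_range _).bddAbove a)

lemma gap_smul {c : ℝ} (hc : 0 ≤ c) (θ : Fin d → ℝ) (x : Fin C) (a : Fin K) :
    M.gap (c • θ) x a = c * M.gap θ x a := by
  simp only [gap, smul_dotProduct, smul_eq_mul, mul_sub, Real.mul_iSup_of_nonneg hc]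

variable {M} {U : Submodule ℝ (Fin d → ℝ)} {ε δ : ℝ} {alg : PassiveAlgorithm C K}
  {σ : History C K → WithTop ℕ}

lemma IsPAC.real_le (h : M.IsPAC U ε δ alg) (hδ : 0 < δ) {θ : Fin d → ℝ} (hθ : θ ∈ U) :
    (M.law θ).real {ω | ∃ x, ε < M.gap θ x (alg.recommend ω x)} ≤ δ :=
  ENNReal.toReal_le_of_le_ofReal hδ.le (h θ hθ).1

/-- Arms of gap exactly `ε` are recommended with probability at most `δ` as well, because they are
not allowed under `(1 + η) • θ`. -/
lemma IsPAC.real_notMem_epsOptimal_le (h : M.IsPAC U ε δ alg) (hδ : 0 < δ)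
    (hσ : IsStoppingTime (dataFiltration C K) σ)
    (hrec : ∀ (A : Set (Fin C → Fin K)) (t : ℕ), MeasurableSet[infoFiltration C K t]
      (alg.recommend ⁻¹' A ∩ {ω | σ ω = t}))
    {θ : Fin d → ℝ} (hθ : θ ∈ U) (hfin : ∫⁻ ω, ENat.toENNReal (σ ω) ∂(M.law θ) ≠ ⊤) (x : Fin C) :
    (M.law θ).real {ω | alg.recommend ω x ∉ M.epsOptimal ε θ x} ≤ δ := by
  set F : Set (History C K) := {ω | alg.recommend ω x ∉ M.epsOptimal ε θ x} with hF
  set p := (M.law θ).real F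
  set c : ℝ := (∫⁻ ω, ENat.toENNReal (σ ω) ∂(M.law θ)).toReal *
    (1 / 2 * (θ ⬝ᵥ M.designMatrix.mulVec θ)) with hc
  have hFpre : F = alg.recommend ⁻¹' {π | π x ∉ M.epsOptimal ε θ x} := rfl
  have hkey : ∀ η : ℝ, η ∈ Set.Ioc (0 : ℝ) 1 → p ≤ δ + η * (δ + c) := by
    rintro η ⟨hη, hη1⟩
    have hU : (1 + η) • θ ∈ U := U.smul_mem _ hθ
    have hq : (M.law ((1 + η) • θ)).real F ≤ δ := by
      refine le_trans (measureReal_mono ?_) (h.real_le hδ hU)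
      intro ω hω
      refine ⟨x, ?_⟩
      simp only [hF, epsOptimal, Set.mem_ofPred_eq, not_or, not_lt] at hω
      rw [M.gap_smul (by positivity)]
      have hpos := lt_of_le_of_ne (M.gap_nonneg θ x (alg.recommend ω x)) (Ne.symm hω.2)
      nlinarith [hω.1]
    -- With weights `η` and `0` the left side is `η * p`, while the divergence term is `η ^ 2 * c`.
    -- Since `exp η - 1 ≤ η + η ^ 2` for `η ≤ 1`, dividing by `η` leaves an error of order `η`.
    have hcm := M.change_of_measure θ ((1 + η) • θ) hσ hfin (E := F)
      (alg.measurableSet_recommend {π | π x ∉ M.epsOptimal ε θ x}) (fun t => hFpre ▸ hrec _ t) η 0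
    have hv : (1 + η) • θ - θ = η • θ := by rw [add_smul, one_smul, add_sub_cancel_left]
    have hexp := (abs_le.1 (Real.abs_exp_sub_one_sub_id_le (x := η)
      (by rw [abs_of_pos hη]; exact hη1))).2
    have hexp1 := Real.add_one_le_exp η
    rw [hv, Matrix.mulVec_smul, dotProduct_smul, smul_dotProduct, smul_eq_mul, smul_eq_mul,
      Real.exp_zero] at hcm
    have hη2 : η * p ≤ η * (δ + η * (δ + c)) := by
      have h1 : (Real.exp η - 1) * (M.law ((1 + η) • θ)).real F ≤ (Real.exp η - 1) * δ :=
        mul_le_mul_of_nonneg_left hq (by linarith)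
      have h2 : (Real.exp η - 1) * δ ≤ (η + η ^ 2) * δ :=
        mul_le_mul_of_nonneg_right (by linarith) hδ.le
      rw [hc]
      linarith
    exact le_of_mul_le_mul_left hη2 hη
  have hlim : Filter.Tendsto (fun η : ℝ => δ + η * (δ + c)) (nhdsWithin 0 (Set.Ioi 0))
      (nhds δ) := by
    have : Continuous fun η : ℝ => δ + η * (δ + c) := by fun_prop
    simpa using (this.tendsto 0).mono_left nhdsWithin_le_nhds
  refine ge_of_tendsto hlim ?_
  filter_upwards [Ioc_mem_nhdsGT (zero_lt_one' ℝ)] with η hη using hkey η hη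

/-- Outside an event of `θ`-probability at most `δ`, the arm recommended at the confusing context
`x` is `ε`-optimal for `θ`, hence a failure for `μ`; under `μ` failures have probability at most
`δ`. -/
lemma IsPAC.bernoulliKL_le (h : M.IsPAC U ε δ alg) (hδ : 0 < δ) (hδ' : δ ≤ 1 / 2)
    (hσ : IsStoppingTime (dataFiltration C K) σ)
    (hrec : ∀ (A : Set (Fin C → Fin K)) (t : ℕ), MeasurableSet[infoFiltration C K t]
      (alg.recommend ⁻¹' A ∩ {ω | σ ω = t}))
    {θ μ : Fin d → ℝ} (hθ : θ ∈ U) (hμ : μ ∈ M.confusing ε θ) (hμU : μ ∈ U)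
    (hfin : ∫⁻ ω, ENat.toENNReal (σ ω) ∂(M.law θ) ≠ ⊤) :
    bernoulliKL δ (1 - δ) ≤ (∫⁻ ω, ENat.toENNReal (σ ω) ∂(M.law θ)).toReal *
      (1 / 2 * ((μ - θ) ⬝ᵥ M.designMatrix.mulVec (μ - θ))) := by
  obtain ⟨x, hx⟩ := hμ
  set G : Set (History C K) := {ω | ∃ x, ε < M.gap μ x (alg.recommend ω x)} with hG
  have hGpre : G = alg.recommend ⁻¹' {π | ∃ x, ε < M.gap μ x (π x)} := rfl
  have hGm : MeasurableSet G :=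
    alg.measurableSet_recommend {π | ∃ x, ε < M.gap μ x (π x)}
  have hFm : MeasurableSet {ω : History C K | alg.recommend ω x ∉ M.epsOptimal ε θ x} :=
    alg.measurableSet_recommend {π | π x ∉ M.epsOptimal ε θ x}
  have hp : 1 - δ ≤ (M.law θ).real G := by
    have h1 := h.real_notMem_epsOptimal_le hδ hσ hrec hθ hfin x
    have h2 := probReal_compl_eq_one_sub (μ := M.law θ) hFm
    have h3 : {ω | alg.recommend ω x ∉ M.epsOptimal ε θ x}ᶜ ⊆ G := by
      intro ω hω
      exact ⟨x, hx _ (not_not.1 hω)⟩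
    have h4 := measureReal_mono (μ := M.law θ) h3
    linarith
  have hq : (M.law μ).real G ≤ δ := h.real_le hδ hμU
  have hr : 1 ≤ (1 - δ) / δ := (one_le_div hδ).2 (by linarith)
  have hr0 : 0 < (1 - δ) / δ := by linarith
  have hc : 0 ≤ Real.log ((1 - δ) / δ) := Real.log_nonneg hr
  -- These weights are the log-likelihood ratios of Bernoulli laws with means `1 - δ` and `δ`, the
  -- optimal choice in the extreme case.
  have hcm := M.change_of_measure θ μ hσ hfin hGm (fun t => hGpre ▸ hrec _ t)
    (Real.log ((1 - δ) / δ)) (-Real.log ((1 - δ) / δ))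
  rw [Real.exp_neg, Real.exp_log hr0] at hcm
  rw [bernoulliKL_symm]
  -- The left side is nondecreasing in the probability of `G`, which is at most `δ`, and equals `1`
  -- at `δ`.
  have h1 : (1 - δ) / δ * (M.law μ).real G + ((1 - δ) / δ)⁻¹ * (1 - (M.law μ).real G) ≤ 1 := by
    have hi : ((1 - δ) / δ)⁻¹ ≤ (1 - δ) / δ := (inv_le_one_of_one_le₀ hr).trans hr
    have h2 : (1 - δ) / δ * δ + ((1 - δ) / δ)⁻¹ * (1 - δ) = 1 := by
      have : 1 - δ ≠ 0 := by linarith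
      field_simp
      ring
    nlinarith
  nlinarith [mul_le_mul_of_nonneg_right hp hc]

/-- The lower bound on the expectation of a time at which the recommendation is known. -/
lemma IsPAC.inv_psi_mul_le (h : M.IsPAC U ε δ alg) (hδ : 0 < δ) (hδ' : δ ≤ 1 / 2)
    (hσ : IsStoppingTime (dataFiltration C K) σ)
    (hrec : ∀ (A : Set (Fin C → Fin K)) (t : ℕ), MeasurableSet[infoFiltration C K t]
      (alg.recommend ⁻¹' A ∩ {ω | σ ω = t}))
    {θ : Fin d → ℝ} (hθ : θ ∈ U) :
    (M.psi U ε θ)⁻¹ * ENNReal.ofReal (bernoulliKL δ (1 - δ)) ≤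
      ∫⁻ ω, ENat.toENNReal (σ ω) ∂(M.law θ) := by
  by_cases hfin : ∫⁻ ω, ENat.toENNReal (σ ω) ∂(M.law θ) = ⊤
  · rw [hfin]; exact le_top
  -- At `δ = 1 / 2` the divergence vanishes and the convention `∞ * 0 = 0` applies. Otherwise a
  -- finite expectation forces `D > 0` for each confusing `μ`.
  rcases le_or_gt (bernoulliKL δ (1 - δ)) 0 with hkl | hkl
  · rw [ENNReal.ofReal_of_nonpos hkl, mul_zero]; exact zero_le
  simp only [psi, ENNReal.inv_iInf, ENNReal.iSup_mul]
  refine iSup₂_le fun μ hμ => ?_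
  have hle := h.bernoulliKL_le hδ hδ' hσ hrec hθ hμ.1 hμ.2 hfin
  have hD0 : 0 ≤ 1 / 2 * ((μ - θ) ⬝ᵥ M.designMatrix.mulVec (μ - θ)) :=
    mul_nonneg (by norm_num) (M.quadratic_nonneg _)
  have hD : 0 < 1 / 2 * ((μ - θ) ⬝ᵥ M.designMatrix.mulVec (μ - θ)) := by
    refine lt_of_le_of_ne hD0 fun h0 => ?_
    rw [← h0, mul_zero] at hle
    exact hkl.not_ge hle
  rw [← ENNReal.ofReal_inv_of_pos hD, ← ENNReal.ofReal_mul (inv_nonneg.2 hD0),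
    ← ENNReal.ofReal_toReal hfin]
  refine ENNReal.ofReal_le_ofReal ?_
  rw [inv_mul_le_iff₀ hD, mul_comm]
  exact hle

theorem IsPAC.inv_psi_mul_le_expectedSamples (h : M.IsPAC U ε δ alg) (hδ : 0 < δ)
    (hδ' : δ ≤ 1 / 2) (hσ : alg.StopsOnData) {θ : Fin d → ℝ} (hθ : θ ∈ U) :
    (M.psi U ε θ)⁻¹ * ENNReal.ofReal (bernoulliKL δ (1 - δ)) ≤ M.expectedSamples θ alg :=
  h.inv_psi_mul_le hδ hδ' hσ alg.measurableSet_recommend_inter_eq hθ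

theorem IsPAC.inv_psi_mul_le_expectedSamples_add_one (h : M.IsPAC U ε δ alg) (hδ : 0 < δ)
    (hδ' : δ ≤ 1 / 2) {θ : Fin d → ℝ} (hθ : θ ∈ U) :
    (M.psi U ε θ)⁻¹ * ENNReal.ofReal (bernoulliKL δ (1 - δ)) ≤ M.expectedSamples θ alg + 1 := by
  refine (h.inv_psi_mul_le hδ hδ' alg.isStoppingTime_add_one
    alg.measurableSet_recommend_inter_add_one_eq hθ).trans_eq ?_
  rw [lintegral_congr fun ω => toENNReal_withTop_add_one (alg.stoppingTime ω),
    lintegral_add_right _ measurable_const]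
  simp [expectedSamples]

end PassiveModel

/-! ### Empirical means and algorithms with a fixed horizon. -/

lemma exists_measurable_argmax {K : ℕ} (hK : 0 < K) :
    ∃ g : (Fin K → ℝ) → Fin K, Measurable g ∧ ∀ (v : Fin K → ℝ) b, v b ≤ v (g v) := by
  classical
  have : Nonempty (Fin K) := ⟨⟨0, hK⟩⟩
  -- Ties go to the least maximising index, which makes the selection measurable.
  have hex : ∀ v : Fin K → ℝ, ∃ n, ∃ h : n < K, ∀ b, v b ≤ v ⟨n, h⟩ := fun v => by
    obtain ⟨i, hi⟩ := Finite.exists_max v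
    exact ⟨i, i.2, hi⟩
  have hm : Measurable fun v : Fin K → ℝ => Nat.find (hex v) := by
    refine measurable_find hex fun n => ?_
    by_cases h : n < K
    · simp only [h, exists_true_left, Set.ofPred_forall]
      exact MeasurableSet.iInter fun b =>
        measurableSet_le (measurable_pi_apply b) (measurable_pi_apply (⟨n, h⟩ : Fin K))
    · simp only [h, IsEmpty.exists_iff]
      exact MeasurableSet.const _
  refine ⟨fun v => ⟨Nat.find (hex v), (Nat.find_spec (hex v)).1⟩, ?_,
    fun v => (Nat.find_spec (hex v)).2⟩
  refine measurable_to_countable' fun i => ?_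
  have h : (fun v : Fin K → ℝ => (⟨Nat.find (hex v), (Nat.find_spec (hex v)).1⟩ : Fin K)) ⁻¹' {i} =
      (fun v : Fin K → ℝ => Nat.find (hex v)) ⁻¹' {(i : ℕ)} := by
    ext v
    simp only [Set.mem_preimage, Set.mem_singleton_iff, Fin.ext_iff]
  rw [h]
  exact hm (measurableSet_singleton _)

/-- Whether the round `w` shows the pair `z` of a context and an arm. -/
noncomputable def hit {C K : ℕ} (z : Fin C × Fin K) (w : Round C K) : ℝ :=
  if (w.1, w.2.1) = z then 1 else 0

/-- The average reward of the pair `z` in `n` rounds. -/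
noncomputable def empiricalMean {C K n : ℕ} (z : Fin C × Fin K) (w : Fin n → Round C K) : ℝ :=
  (∑ s, hit z (w s) * (w s).2.2) / ∑ s, hit z (w s)

/-- The first `n` rounds. -/
def firstRounds (C K n : ℕ) (ω : History C K) : Fin n → Round C K := fun s => ω s

section

variable {C K n : ℕ} (z : Fin C × Fin K)

lemma measurable_hit : Measurable (hit z : Round C K → ℝ) :=
  PassiveModel.measurable_of_contexts_arms fun x a => measurable_const (a := hit z (x, a, 0))

lemma measurable_hit_mul_reward : Measurable fun w : Round C K => hit z w * w.2.2 :=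
  (measurable_hit z).mul (by fun_prop)

lemma measurable_empiricalMean :
    Measurable (empiricalMean z : (Fin n → Round C K) → ℝ) :=
  (Finset.measurable_fun_sum _ fun s _ =>
      (measurable_hit_mul_reward z).comp (measurable_pi_apply s)).div
    (Finset.measurable_fun_sum _ fun s _ => (measurable_hit z).comp (measurable_pi_apply s))

lemma measurable_firstRounds_dataSigma : Measurable[dataSigma C K n] (firstRounds C K n) := by
  refine @measurable_pi_lambda _ _ _ (dataSigma C K n) _ _ fun s => ?_
  refine Measurable.mono (comap_measurable _)
    (le_iSup (fun r : Fin n => MeasurableSpace.comap (fun ω : History C K => ω r) inferInstance) s)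
    le_rfl

lemma measurable_firstRounds : Measurable (firstRounds C K n) :=
  measurable_firstRounds_dataSigma.mono ((dataFiltration C K).le n) le_rfl

/-- The algorithm that stops after `n` rounds and computes a policy from them. -/
def fixedHorizon (n : ℕ) (π : (Fin n → Round C K) → Fin C → Fin K) (hπ : Measurable π) :
    PassiveAlgorithm C K where
  stoppingTime _ := (n : WithTop ℕ)
  isStoppingTime := isStoppingTime_const (infoFiltration C K) n
  recommend ω := π (firstRounds C K n ω)
  measurable_recommend := by
    rw [IsStoppingTime.measurableSpace_const]
    exact (hπ.comp measurable_firstRounds_dataSigma).mono le_sup_left le_rfl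

lemma stopsOnData_fixedHorizon (π : (Fin n → Round C K) → Fin C → Fin K) (hπ : Measurable π) :
    (fixedHorizon n π hπ).StopsOnData :=
  isStoppingTime_const (dataFiltration C K) n

end

/-! ### Learnability: accuracy of the estimates uniformly over the parameters. -/

namespace PassiveModel

variable {d C K : ℕ} (M : PassiveModel d C K)

lemma law_eq_map_shift (θ : Fin d → ℝ) :
    M.law θ = (M.law 0).map fun ω s => M.shift θ (ω s) := by
  rw [law, law, Measure.infinitePi_map_pi _ fun _ => M.measurable_shift θ]
  simp only [M.map_shift_roundLaw]

/-- Without a hit both empirical means are `0 / 0 = 0` and the translation is lost, hence `hw`. -/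
lemma empiricalMean_shift {n : ℕ} (θ : Fin d → ℝ) (z : Fin C × Fin K) {w : Fin n → Round C K}
    (hw : 0 < ∑ s, hit z (w s)) :
    empiricalMean z (fun s => M.shift θ (w s)) =
      empiricalMean z w + θ ⬝ᵥ M.feature z.1 z.2 := by
  have h1 : ∀ s, hit z (M.shift θ (w s)) = hit z (w s) := fun s => rfl
  have h2 : ∀ s, hit z (w s) * (M.shift θ (w s)).2.2 =
      hit z (w s) * (w s).2.2 + hit z (w s) * θ ⬝ᵥ M.feature z.1 z.2 := fun s => by
    simp only [hit, shift]
    split_ifs with h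
    · rw [← h]; ring
    · ring
  simp only [empiricalMean, h1, h2]
  rw [Finset.sum_add_distrib, ← Finset.sum_mul]
  field_simp

lemma ae_tendsto_average (θ : Fin d → ℝ) {g : Round C K → ℝ} (hg : Measurable g)
    (hgi : Integrable g (M.roundLaw θ)) :
    ∀ᵐ ω ∂(M.law θ), Filter.Tendsto
      (fun n : ℕ => (∑ s, g (firstRounds C K n ω s)) / (n : ℝ)) Filter.atTop
      (nhds (∫ w, g w ∂(M.roundLaw θ))) := by
  have hmp := fun s : ℕ => measurePreserving_eval_infinitePi (fun _ : ℕ => M.roundLaw θ) s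
  have hind : iIndepFun (fun s (ω : History C K) => g (ω s)) (M.law θ) :=
    iIndepFun_infinitePi (X := fun _ => g) fun _ => hg
  have hmap : ∀ s : ℕ, (M.law θ).map (fun ω : History C K => g (ω s)) =
      (M.roundLaw θ).map g := fun s => by
    rw [← (hmp s).map_eq, Measure.map_map hg (hmp s).measurable]
    rfl
  have hm : ∀ s : ℕ, Measurable fun ω : History C K => g (ω s) :=
    fun s => hg.comp (measurable_pi_apply s)
  have h := strong_law_ae_real (μ := M.law θ) (fun s (ω : History C K) => g (ω s))
    ((hmp 0).integrable_comp_of_integrable hgi) (fun i j hij => hind.indepFun hij)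
    fun s => ⟨(hm s).aemeasurable, (hm 0).aemeasurable, by rw [hmap, hmap]⟩
  have h0 : ∫ ω, g (ω 0) ∂(M.law θ) = ∫ w, g w ∂(M.roundLaw θ) := by
    rw [← (hmp 0).map_eq, integral_map (hmp 0).measurable.aemeasurable hg.aestronglyMeasurable]
    rfl
  rw [h0] at h
  filter_upwards [h] with ω hω
  refine hω.congr fun n => ?_
  rw [Finset.sum_range]
  rfl

lemma integrable_id_gaussianReal (m : ℝ) : Integrable (fun r => r) (gaussianReal m 1) :=
  (memLp_id_gaussianReal 1).integrable (by simp)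

lemma integrable_hit (z : Fin C × Fin K) : Integrable (hit z) (M.roundLaw 0) :=
  M.integrable_roundLaw 0 (fun x a => integrable_const (hit z (x, a, 0))) (measurable_hit z)

lemma integral_hit (z : Fin C × Fin K) :
    ∫ w, hit z w ∂(M.roundLaw 0) =
      (M.contextDist z.1).toReal * (M.allocation z.1 z.2).toReal := by
  rw [M.integral_roundLaw 0 (fun x a => integrable_const (hit z (x, a, 0))) (measurable_hit z)]
  rw [Finset.sum_eq_single z.1, Finset.sum_eq_single z.2]
  · simp [hit]
  · intro a _ ha
    simp [hit, Prod.ext_iff, ha]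
  · simp
  · intro x _ hx
    simp [hit, Prod.ext_iff, hx]
  · simp

lemma integrable_hit_mul_reward_gaussianReal (z : Fin C × Fin K) (x : Fin C) (a : Fin K) (m : ℝ) :
    Integrable (fun r => hit z (x, a, r) * r) (gaussianReal m 1) :=
  (integrable_id_gaussianReal m).const_mul (hit z (x, a, 0))

lemma integrable_hit_mul_reward (z : Fin C × Fin K) :
    Integrable (fun w => hit z w * w.2.2) (M.roundLaw 0) :=
  M.integrable_roundLaw 0 (fun x a => integrable_hit_mul_reward_gaussianReal z x a _)
    (measurable_hit_mul_reward z)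

lemma integral_hit_mul_reward (z : Fin C × Fin K) :
    ∫ w, hit z w * w.2.2 ∂(M.roundLaw 0) = 0 := by
  rw [M.integral_roundLaw 0 (fun x a => integrable_hit_mul_reward_gaussianReal z x a _)
    (measurable_hit_mul_reward z)]
  refine Finset.sum_eq_zero fun x _ => Finset.sum_eq_zero fun a _ => ?_
  have h : ∫ r, hit z (x, a, r) * r ∂(gaussianReal (0 ⬝ᵥ M.feature x a) 1) =
      hit z (x, a, 0) * ∫ r, r ∂(gaussianReal (0 ⬝ᵥ M.feature x a) 1) :=
    integral_const_mul (hit z (x, a, 0)) fun r : ℝ => r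
  rw [h, integral_id_gaussianReal, zero_dotProduct, mul_zero, mul_zero]

/-- The empirical mean is a quotient of two averages over rounds: the numerator tends to `0`, the
denominator to the positive probability of the pair `z`. -/
lemma ae_eventually_empiricalMean {z : Fin C × Fin K} (hx : 0 < M.contextDist z.1)
    (ha : 0 < M.allocation z.1 z.2) {η : ℝ} (hη : 0 < η) :
    ∀ᵐ ω ∂(M.law 0), ∀ᶠ n in Filter.atTop, 0 < ∑ s, hit z (firstRounds C K n ω s) ∧
      |empiricalMean z (firstRounds C K n ω)| < η := by
  have hpos : 0 < (M.contextDist z.1).toReal * (M.allocation z.1 z.2).toReal :=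
    mul_pos (ENNReal.toReal_pos hx.ne' (PMF.apply_ne_top _ _))
      (ENNReal.toReal_pos ha.ne' (PMF.apply_ne_top _ _))
  filter_upwards [M.ae_tendsto_average 0 (measurable_hit z) (M.integrable_hit z),
    M.ae_tendsto_average 0 (measurable_hit_mul_reward z) (M.integrable_hit_mul_reward z)]
    with ω h1 h2
  rw [M.integral_hit] at h1
  rw [M.integral_hit_mul_reward] at h2
  have h3 := (h2.div h1 hpos.ne').abs
  rw [zero_div, abs_zero] at h3
  filter_upwards [h1.eventually (lt_mem_nhds hpos), h3.eventually (gt_mem_nhds hη),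
    Filter.eventually_gt_atTop 0] with n hn1 hn2 hn
  have hn' : (0 : ℝ) < n := by exact_mod_cast hn
  refine ⟨(div_pos_iff_of_pos_right hn').1 hn1, ?_⟩
  simp only [Pi.div_apply] at hn2
  rwa [div_div_div_cancel_right₀ hn'.ne'] at hn2

/-- The histories for which the first `n` rounds estimate the means of all sampled pairs up to
`η` when all of these means vanish. -/
def accurate (n : ℕ) (η : ℝ) : Set (History C K) :=
  {ω | ∀ z : Fin C × Fin K, 0 < M.allocation z.1 z.2 →
    0 < ∑ s, hit z (firstRounds C K n ω s) ∧ |empiricalMean z (firstRounds C K n ω)| < η}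

lemma measurableSet_accurate (n : ℕ) (η : ℝ) : MeasurableSet (M.accurate n η) := by
  simp only [accurate, Set.ofPred_forall]
  refine MeasurableSet.iInter fun z => MeasurableSet.iInter fun _ => MeasurableSet.inter ?_ ?_
  · exact measurableSet_lt (g := fun ω => ∑ s, hit z (firstRounds C K n ω s)) measurable_const
      (Finset.measurable_fun_sum _ fun s _ => (measurable_hit z).comp (measurable_pi_apply (s : ℕ)))
  · exact measurableSet_lt (f := fun ω => |empiricalMean z (firstRounds C K n ω)|)
      ((measurable_empiricalMean z).comp measurable_firstRounds).abs measurable_const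

lemma exists_law_compl_accurate_le (hp : ∀ x, 0 < M.contextDist x) {η δ : ℝ} (hη : 0 < η)
    (hδ : 0 < δ) : ∃ n, M.law 0 (M.accurate n η)ᶜ ≤ ENNReal.ofReal δ := by
  -- Almost every history is eventually accurate, so the indicators of the complements tend to `0`,
  -- and then so do their measures.
  have h : ∀ᵐ ω ∂(M.law 0), ∀ᶠ n in Filter.atTop, ω ∈ (M.accurate n η)ᶜ ↔
      ω ∈ (∅ : Set (History C K)) := by
    have h1 : ∀ᵐ ω ∂(M.law 0), ∀ z : Fin C × Fin K, 0 < M.allocation z.1 z.2 →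
        ∀ᶠ n in Filter.atTop, 0 < ∑ s, hit z (firstRounds C K n ω s) ∧
          |empiricalMean z (firstRounds C K n ω)| < η := by
      refine ae_all_iff.2 fun z => ?_
      by_cases ha : 0 < M.allocation z.1 z.2
      · filter_upwards [M.ae_eventually_empiricalMean (hp z.1) ha hη] with ω hω _ using hω
      · exact Filter.Eventually.of_forall fun _ h => absurd h ha
    filter_upwards [h1] with ω hω
    have h2 : ∀ᶠ n in Filter.atTop, ω ∈ M.accurate n η := by
      refine Filter.eventually_all.2 fun z => ?_
      by_cases ha : 0 < M.allocation z.1 z.2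
      · filter_upwards [hω z ha] with n hn _ using hn
      · exact Filter.Eventually.of_forall fun _ h => absurd h ha
    filter_upwards [h2] with n hn
    simp [hn]
  have hlim := tendsto_measure_of_ae_tendsto_indicator_of_isFiniteMeasure Filter.atTop
    MeasurableSet.empty (fun n => (M.measurableSet_accurate n η).compl) h
  rw [measure_empty] at hlim
  exact ((hlim.eventually (gt_mem_nhds (ENNReal.ofReal_pos.2 hδ))).exists).imp fun _ h => h.le

/-- On the span of the sampled features, every linear functional is determined by the sampled
features. -/
lemma exists_coefficients (v : Fin d → ℝ) :
    ∃ c : Fin C × Fin K → ℝ, (∀ z, ¬ 0 < M.allocation z.1 z.2 → c z = 0) ∧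
      ∀ θ ∈ Submodule.span ℝ M.sampledFeatures,
        θ ⬝ᵥ v = ∑ z, c z * θ ⬝ᵥ M.feature z.1 z.2 := by
  classical
  set S := Submodule.span ℝ M.sampledFeatures
  let φ : Fin C × Fin K → Fin d → ℝ := fun z =>
    if 0 < M.allocation z.1 z.2 then M.feature z.1 z.2 else 0
  let ev : (Fin d → ℝ) → S →ₗ[ℝ] ℝ := fun u => (dotProductBilin ℝ ℝ u).comp S.subtype
  have hev : ∀ u (θ : S), ev u θ = (θ : Fin d → ℝ) ⬝ᵥ u :=
    fun u θ => dotProduct_comm u (θ : Fin d → ℝ)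
  -- A functional that vanishes on the common kernel of finitely many others is a combination of
  -- them. Here that kernel is trivial: its elements are orthogonal to `S` and lie in `S`, so to
  -- themselves.
  have hker : ⨅ z, LinearMap.ker (ev (φ z)) ≤ LinearMap.ker (ev v) := by
    intro θ hθ
    have hθ0 : ∀ u ∈ S, (θ : Fin d → ℝ) ⬝ᵥ u = 0 := by
      intro u hu
      induction hu using Submodule.span_induction with
      | mem u hu =>
        obtain ⟨x, a, ha, rfl⟩ := hu
        have h := (Submodule.mem_iInf _).1 hθ (x, a)
        rw [LinearMap.mem_ker, hev] at h
        simpa [φ, ha] using h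
      | zero => simp
      | add u w _ _ hu hw => rw [dotProduct_add, hu, hw, add_zero]
      | smul r u _ hu => rw [dotProduct_smul, hu, smul_zero]
    have h0 : (θ : Fin d → ℝ) = 0 := dotProduct_self_eq_zero.1 (hθ0 θ θ.2)
    rw [LinearMap.mem_ker, hev, h0, zero_dotProduct]
  obtain ⟨c, hc⟩ := (Submodule.mem_span_range_iff_exists_fun ℝ).1
    (mem_span_of_iInf_ker_le_ker hker)
  refine ⟨fun z => if 0 < M.allocation z.1 z.2 then c z else 0, fun z hz => if_neg hz,
    fun θ hθ => ?_⟩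
  have h := congrArg (fun f => f ⟨θ, hθ⟩) hc
  simp only [LinearMap.sum_apply, LinearMap.smul_apply, hev, smul_eq_mul] at h
  rw [← h]
  refine Finset.sum_congr rfl fun z _ => ?_
  by_cases hz : 0 < M.allocation z.1 z.2 <;> simp [φ, hz]

lemma gap_le_of_estimate {θ : Fin d → ℝ} {x : Fin C} {e : Fin K → ℝ} {η : ℝ} {a : Fin K}
    (he : ∀ b, |e b - θ ⬝ᵥ M.feature x b| ≤ η) (ha : ∀ b, e b ≤ e a) :
    M.gap θ x a ≤ 2 * η := by
  have : Nonempty (Fin K) := ⟨a⟩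
  rw [gap, sub_le_iff_le_add]
  refine ciSup_le fun b => ?_
  have h1 := (abs_le.1 (he b)).1
  have h2 := (abs_le.1 (he a)).2
  linarith [ha b]

theorem exists_isPAC (hp : ∀ x, 0 < M.contextDist x) {U : Submodule ℝ (Fin d → ℝ)}
    (hU : U ≤ Submodule.span ℝ M.sampledFeatures) {ε δ : ℝ} (hε : 0 < ε) (hδ : 0 < δ) :
    ∃ alg : PassiveAlgorithm C K, alg.StopsOnData ∧ M.IsPAC U ε δ alg := by
  obtain ⟨x₀, -⟩ := M.contextDist.support_nonempty
  obtain ⟨a₀, -⟩ := (M.allocation x₀).support_nonempty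
  obtain ⟨g, hgm, hg⟩ := exists_measurable_argmax (Fin.pos a₀)
  choose c hc0 hc using fun x b => M.exists_coefficients (M.feature x b)
  -- `H` bounds the amplification of errors by every row of coefficients; the `1` keeps it positive.
  -- Accuracy `ε / (2 * H)` then gives estimates within `ε / 2`, and comparing two arms doubles
  -- this.
  set H : ℝ := 1 + ∑ x, ∑ b, ∑ z, |c x b z| with hH
  have hHpos : 0 < H := by positivity
  have hcH : ∀ x b, ∑ z, |c x b z| ≤ H := fun x b => by
    have h1 : ∑ z, |c x b z| ≤ ∑ b, ∑ z, |c x b z| :=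
      Finset.single_le_sum (f := fun b => ∑ z, |c x b z|)
        (fun _ _ => Finset.sum_nonneg fun _ _ => abs_nonneg _) (Finset.mem_univ b)
    have h2 : ∑ b, ∑ z, |c x b z| ≤ ∑ x, ∑ b, ∑ z, |c x b z| :=
      Finset.single_le_sum (f := fun x => ∑ b, ∑ z, |c x b z|)
        (fun _ _ => Finset.sum_nonneg fun _ _ => Finset.sum_nonneg fun _ _ => abs_nonneg _)
        (Finset.mem_univ x)
    linarith
  set η : ℝ := ε / (2 * H) with hηdef
  have hη : 0 < η := by positivity
  obtain ⟨n, hn⟩ := M.exists_law_compl_accurate_le hp hη hδ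
  let π : (Fin n → Round C K) → Fin C → Fin K :=
    fun w x => g fun b => ∑ z, c x b z * empiricalMean z w
  have hπ : Measurable π := measurable_pi_lambda _ fun x => hgm.comp <|
    measurable_pi_lambda _ fun b => Finset.measurable_fun_sum _ fun z _ =>
      (measurable_empiricalMean z).const_mul _
  refine ⟨fixedHorizon n π hπ, stopsOnData_fixedHorizon π hπ, fun θ hθ => ⟨?_, ?_⟩⟩
  · have hbad : MeasurableSet
        {ω | ∃ x, ε < M.gap θ x ((fixedHorizon n π hπ).recommend ω x)} :=
      (fixedHorizon n π hπ).measurableSet_recommend {ρ | ∃ x, ε < M.gap θ x (ρ x)}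
    have hshift : Measurable fun (ω : History C K) (s : ℕ) => M.shift θ (ω s) :=
      measurable_pi_lambda _ fun s => (M.measurable_shift θ).comp (measurable_pi_apply s)
    -- Under the law at `0` the bad event of every `θ` lies in the complement of one and the same
    -- accurate event, so `n` does not depend on `θ`.
    rw [M.law_eq_map_shift θ, Measure.map_apply hshift hbad]
    refine (measure_mono ?_).trans hn
    rintro ω ⟨x, hx⟩ hω
    refine hx.not_ge ?_
    have h2 : 2 * (H * η) = ε := by rw [hηdef]; field_simp
    rw [← h2]
    refine M.gap_le_of_estimate
      (e := fun b => ∑ z, c x b z * empiricalMean z fun s => M.shift θ (firstRounds C K n ω s))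
      (fun b => ?_) (hg _)
    rw [hc x b θ (hU hθ), ← Finset.sum_sub_distrib]
    refine (Finset.abs_sum_le_sum_abs _ _).trans ?_
    refine le_trans ?_ (mul_le_mul_of_nonneg_right (hcH x b) hη.le)
    rw [Finset.sum_mul]
    refine Finset.sum_le_sum fun z _ => ?_
    by_cases hz : 0 < M.allocation z.1 z.2
    · rw [M.empiricalMean_shift θ z (hω z hz).1, ← mul_sub, add_sub_cancel_right, abs_mul]
      exact mul_le_mul_of_nonneg_left (hω z hz).2.le (abs_nonneg _)
    · simp [hc0 x b z hz]
  · have huniv : {ω | (fixedHorizon n π hπ).stoppingTime ω < ⊤} = Set.univ :=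
      Set.eq_univ_of_forall fun _ => WithTop.coe_lt_top n
    rw [huniv, measure_univ]

end PassiveModel

end CLMAB

theorem theorem2 {d C K : ℕ} (M : CLMAB.PassiveModel d C K)
    (hp : ∀ x, 0 < M.contextDist x)
    (U : Submodule ℝ (Fin d → ℝ)) (hU : U ≤ Submodule.span ℝ M.sampledFeatures) :
    M.IsPACLearnable U ∧
    (∀ ε δ : ℝ, 0 < ε → 0 < δ → δ < 1 →
      ∃ alg : CLMAB.PassiveAlgorithm C K, alg.StopsOnData ∧ M.IsPAC U ε δ alg) ∧
    (∀ ε δ : ℝ, 0 ≤ ε → 0 < δ → δ ≤ 1 / 2 →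
      ∀ alg : CLMAB.PassiveAlgorithm C K, M.IsPAC U ε δ alg → ∀ θ ∈ U,
        (alg.StopsOnData →
          (M.psi U ε θ)⁻¹ * ENNReal.ofReal (CLMAB.bernoulliKL δ (1 - δ))
            ≤ M.expectedSamples θ alg) ∧
        (M.psi U ε θ)⁻¹ * ENNReal.ofReal (CLMAB.bernoulliKL δ (1 - δ))
          ≤ M.expectedSamples θ alg + 1) := by
  refine ⟨?_, fun ε δ hε hδ _ => M.exists_isPAC hp hU hε hδ,
    fun ε δ _ hδ hδ' alg h θ hθ => ⟨fun hσ => ?_, ?_⟩⟩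
  · obtain ⟨alg, -, h⟩ := M.exists_isPAC hp hU one_pos (half_pos one_pos)
    exact ⟨1, 1 / 2, zero_le_one, by norm_num, by norm_num, alg, h⟩
  · exact h.inv_psi_mul_le_expectedSamples hδ hδ' hσ hθ
  · exact h.inv_psi_mul_le_expectedSamples_add_one hδ hδ' hθ
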